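/- **Setting.** Let $\mathcal X,U\subset\mathbb R$ be compact and let $\mathcal P(\mathcal X)$ be the Borel probability measures on $\mathcal X$, with $\mathbf d_1(m,m')=\sup\{\int\varphi\,d(m-m'):\varphi\ 1\text{-Lipschitz}\}$. Write $m^M_X=\frac1M\sum_{i=1}^M\delta_{x_i}$ for $X\in\mathcal X^M$ and $X_{-i}=(x_j)_{j\ne i}$. A modulus is a function $\omega$ with $\omega(t)\to0$ as $t\downarrow0$ and $\omega(0)=0$; every modulus below is independent of the number $M$ of agents. For every $M\ge1$ let $g=g_M:\mathcal X\times\mathcal X^{M-1}\to\mathbb R$ be symmetric in the last $M-1$ variables, bounded uniformly in $M$, with $|g(x,X_{-i})-g(y,Y_{-i})|\le\omega(|x-y|)+\omega(\mathbf d_1(m^{M-1}_{X_{-i}},m^{M-1}_{Y_{-i}}))$. The microscopic dynamics is $$x_{i,n+1}=x_{i,n}+g(x_{i,n},X_{-i,n})+u_n,\qquad u_n\in U,$$ and it is assumed that a step with any $u\in U$ maps $\mathcal X^M$ into itself. Let the running costs $\ell_M:\mathcal X^M\times U\to[0,\infty)$ be symmetric in $X$, bounded uniformly in $M$, with $|\ell_M(X,u)-\ell_M(Y,v)|\le\omega(\mathbf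 d_1(m^M_X,m^M_Y))+\omega(|u-v|)$. (For example $\ell_M(X,u)=\ell(m_X^M,u)$, with $\ell$ bounded, Lipschitz in $\mathbf d_1$ and continuous in $u$, uniformly.) Put $\ell_M^*(X)=\inf_{u\in U}\ell_M(X,u)$, $J^u_{N,M}(X_0)=\sum_{n=0}^{N-1}\ell_M(X_n,u_n)$ and $V_{N,M}(X_0)=\inf_uJ^u_{N,M}(X_0)$. An $N$-step MPC feedback is a map $\mu_M:\mathcal X^M\to U$ such that, for each $X$, $\mu_M(X)=v_0$ for some minimizer $(v_n)$ of $J^{\,\cdot}_{N,M}(X)$. Let $C\ge1$, $\sigma\in(0,1)$, $\beta(r,n)=C\sigma^nr$. Exponential controllability for $M$ agents means: for every $X_0\in\mathcal X^M$ there is a control sequence with $\ell_M(X_n,u_n)\le\beta(\ell_M^*(X_0),n)$ for all $n\ge0$. **Mean-field objects.** Continuous functions $G:\mathcal X\times\mathcal P(\mathcal X)\to\mathbb R$, $\ell:\mathcal P(\mathcal X)\times U\to\mathbb R$, $\mu:\mathcal P(\mathcal X)\to U$ are called mean-field limits of $g,\ell_M,\mu_M$ along a strictly increasing sequence $(M_k)$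 if $$\sup_{x,\,X\in\mathcal X^{M_k-1}}|g(x,X)-G(x,m^{M_k-1}_X)|,\quad \sup_{X\in\mathcal X^{M_k},\,u\in U}|\ell_{M_k}(X,u)-\ell(m_X^{M_k},u)|,\quad \sup_{X\in\mathcal X^{M_k}}|\mu_{M_k}(X)-\mu(m_X^{M_k})|$$ tend to $0$. The mean-field dynamics for $f_0\in\mathcal P(\mathcal X)$ and controls $u_n\in U$ is $$f_{n+1}=\big(x\mapsto x+G(x,f_n)+u_n\big)_{\#}f_n .$$ Put $J^u_\infty(f_0)=\sum_{n\ge0}\ell(f_n,u_n)\in[0,\infty]$, $V_\infty(f_0)=\inf_uJ^u_\infty(f_0)$ and $V_N(f_0)=\inf_u\sum_{n=0}^{N-1}\ell(f_n,u_n)$. **Lemma.** Let $N\ge2$ and $\alpha\in(0,1]$ be such that all numbers $\lambda_0,\dots,\lambda_{N-1}>0$ and $\nu>0$ with $$\sum_{n=k}^{N-1}\lambda_n\le C\lambda_k\frac{1-\sigma^{N-k}}{1-\sigma}\quad(k=0,\dots,N-2),$$ $$\nu\le\sum_{n=0}^{j-1}\lambda_{n+1}+C\lambda_{j+1}\frac{1-\sigma^{N-j}}{1-\sigma}\quad(j=0,\dots,N-2)$$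 satisfy $\sum_{n=0}^{N-1}\lambda_n-\nu\ge\alpha\lambda_0$. 1. For every $M\ge1$ for which exponential controllability holds, every $N$-step MPC feedback $\mu_M$ and every $X_0\in\mathcal X^M$, $$V_{N,M}(X_0)\ge V_{N,M}(X_1)+\alpha\,\ell_M(X_0,\mu_M(X_0)),\qquad X_1=\big(x_{i,0}+g(x_{i,0},X_{-i,0})+\mu_M(X_0)\big)_{i=1}^M .$$ 2. Suppose exponential controllability holds for all $M$ and $(\mu_M)_M$ is a family of $N$-step MPC feedbacks which are symmetric with $|\mu_M(X)-\mu_M(Y)|\le\omega(\mathbf d_1(m^M_X,m^M_Y))$. Then every strictly increasing sequence of numbers of agents has a subsequence along which mean-field limits $G,\ell,\mu$ exist. For any such limits: the mean-field dynamics has exactly one solution in $\mathcal P(\mathcal X)$ for every $f_0\in\mathcal P(\mathcal X)$ and every control sequence, and exactly one solution in closed loop with $u_n=\mu(f_n)$; $V_N$ is continuous and is the mean-field limit of $V_{N,M}$ (that is, $\sup_{X\in\mathcal X^{M_k}}|V_{N,M_k}(X)-V_N(m^{M_k}_X)|\to0$); and for all $f\in\mathcal P(\mathcal X)$, with $u_n=\mu(f_n)$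 along the closed-loop solution from $f_0=f$, $$\alpha V_\infty(f)\le\alpha J^u_\infty(f)\le V_N(f).$$ -/

import Mathlib

open MeasureTheory Filter Topology
open scoped ENNReal

namespace MeanFieldMPC

noncomputable section

/-! ## Empirical measures and the Kantorovich–Rubinstein distance -/

/-- The empirical measure `(1/m) ∑ δ_{X i}` of a configuration of `m` points
(for `m = 0` it is the zero measure). -/
def empiricalMeasure {𝒳 : Set ℝ} {m : ℕ} (X : Fin m → 𝒳) : Measure 𝒳 :=
  (m : ℝ≥0∞)⁻¹ • ∑ i, Measure.dirac (X i)

theorem isProbabilityMeasure_empiricalMeasure {𝒳 : Set ℝ} {m : ℕ} [NeZero m]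
    (X : Fin m → 𝒳) : IsProbabilityMeasure (empiricalMeasure X) := by
  constructor
  have h0 : (m : ℝ≥0∞) ≠ 0 := by exact_mod_cast NeZero.ne m
  simp [empiricalMeasure, ENNReal.inv_mul_cancel h0 (ENNReal.natCast_ne_top m)]

/-- The empirical measure of `m ≥ 1` points, as an element of `P(𝒳)`. -/
def empirical {𝒳 : Set ℝ} {m : ℕ} [NeZero m] (X : Fin m → 𝒳) : ProbabilityMeasure 𝒳 :=
  ⟨empiricalMeasure X, isProbabilityMeasure_empiricalMeasure X⟩

/-- The distance `d₁(μ, ν) = sup {∫ φ d(μ - ν) : φ 1-Lipschitz}`. -/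
def d₁ {𝒳 : Set ℝ} (μ ν : Measure 𝒳) : ℝ :=
  sSup {r : ℝ | ∃ φ : 𝒳 → ℝ, LipschitzWith 1 φ ∧ r = ∫ x, φ x ∂μ - ∫ x, φ x ∂ν}

/-- A modulus of continuity: `ω(t) → 0` as `t → 0`, `t ≥ 0` (in particular `ω(0) = 0`). -/
def IsModulus (ω : ℝ → ℝ) : Prop := Tendsto ω (𝓝[≥] 0) (𝓝 0)

/-! ## The microscopic problem

All families are indexed by the number `m` of agents other than a given one, so that
index `m` is the system of `M = m + 1 ≥ 1` agents. -/

/-- Interactions `g(x_i, X_{-i})`, one for each number of agents. -/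
abbrev Interaction (𝒳 : Set ℝ) : Type := ∀ m : ℕ, 𝒳 → (Fin m → 𝒳) → ℝ

/-- Running costs `ℓ_M(X, u)`. -/
abbrev RunningCost (𝒳 U : Set ℝ) : Type := ∀ m : ℕ, (Fin (m + 1) → 𝒳) → U → ℝ

/-- Feedback laws `μ_M(X)`. -/
abbrev Feedback (𝒳 U : Set ℝ) : Type := ∀ m : ℕ, (Fin (m + 1) → 𝒳) → U

/-- The state `X_{-i}` of all agents except the `i`-th. -/
def others {𝒳 : Set ℝ} {m : ℕ} (X : Fin (m + 1) → 𝒳) (i : Fin (m + 1)) : Fin m → 𝒳 :=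
  fun j => X (i.succAbove j)

/-- Symmetry in the other agents, uniform boundedness, and a common modulus of continuity. -/
structure IsRegularInteraction {𝒳 : Set ℝ} (g : Interaction 𝒳) : Prop where
  symm : ∀ (m : ℕ) (τ : Equiv.Perm (Fin m)) (x : 𝒳) (X : Fin m → 𝒳), g m x (X ∘ τ) = g m x X
  bounded : ∃ B : ℝ, ∀ (m : ℕ) (x : 𝒳) (X : Fin m → 𝒳), |g m x X| ≤ B
  equicontinuous : ∃ ω : ℝ → ℝ, IsModulus ω ∧
    ∀ (m : ℕ) (x y : 𝒳) (X Y : Fin m → 𝒳),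
      |g m x X - g m y Y| ≤ ω |(x : ℝ) - y| + ω (d₁ (empiricalMeasure X) (empiricalMeasure Y))

/-- Nonnegativity, symmetry, uniform boundedness, and a common modulus of continuity. -/
structure IsRegularCost {𝒳 U : Set ℝ} (ℓ : RunningCost 𝒳 U) : Prop where
  nonneg : ∀ (m : ℕ) (X : Fin (m + 1) → 𝒳) (u : U), 0 ≤ ℓ m X u
  symm : ∀ (m : ℕ) (τ : Equiv.Perm (Fin (m + 1))) (X : Fin (m + 1) → 𝒳) (u : U),
    ℓ m (X ∘ τ) u = ℓ m X u
  bounded : ∃ B : ℝ, ∀ (m : ℕ) (X : Fin (m + 1) → 𝒳) (u : U), |ℓ m X u| ≤ B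
  equicontinuous : ∃ ω : ℝ → ℝ, IsModulus ω ∧
    ∀ (m : ℕ) (X Y : Fin (m + 1) → 𝒳) (u v : U),
      |ℓ m X u - ℓ m Y v| ≤
        ω (d₁ (empiricalMeasure X) (empiricalMeasure Y)) + ω |(u : ℝ) - v|

/-- Symmetry and a common modulus of continuity (uniform boundedness being automatic
for laws with values in a bounded set). -/
structure IsRegularFeedback {𝒳 U : Set ℝ} (μM : Feedback 𝒳 U) : Prop where
  symm : ∀ (m : ℕ) (τ : Equiv.Perm (Fin (m + 1))) (X : Fin (m + 1) → 𝒳), μM m (X ∘ τ) = μM m X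
  equicontinuous : ∃ ω : ℝ → ℝ, IsModulus ω ∧
    ∀ (m : ℕ) (X Y : Fin (m + 1) → 𝒳),
      |(μM m X : ℝ) - μM m Y| ≤ ω (d₁ (empiricalMeasure X) (empiricalMeasure Y))

/-- The agents stay in `𝒳` whatever admissible control value is applied. -/
def StaysIn {𝒳 : Set ℝ} (U : Set ℝ) (g : Interaction 𝒳) : Prop :=
  ∀ (m : ℕ) (X : Fin (m + 1) → 𝒳) (u : U) (i : Fin (m + 1)),
    (X i : ℝ) + g m (X i) (others X i) + u ∈ 𝒳

/-- One step `x_i ↦ x_i + g(x_i, X_{-i}) + u` of the microscopic dynamics. -/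
def microStep {𝒳 U : Set ℝ} {g : Interaction 𝒳} (hg : StaysIn U g) {m : ℕ}
    (X : Fin (m + 1) → 𝒳) (u : U) : Fin (m + 1) → 𝒳 :=
  fun i => ⟨(X i : ℝ) + g m (X i) (others X i) + u, hg m X u i⟩

/-- The microscopic trajectory `(X_n)` for the control sequence `u` and `X_0 = X`. -/
def microTraj {𝒳 U : Set ℝ} {g : Interaction 𝒳} (hg : StaysIn U g) {m : ℕ}
    (X : Fin (m + 1) → 𝒳) (u : ℕ → U) : ℕ → (Fin (m + 1) → 𝒳)
  | 0 => X
  | n + 1 => microStep hg (microTraj hg X u n) (u n)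

/-- The finite horizon cost `J_{N,M}^u(X) = ∑_{n < N} ℓ_M(X_n, u_n)`. -/
def microCost {𝒳 U : Set ℝ} {g : Interaction 𝒳} (hg : StaysIn U g) (ℓ : RunningCost 𝒳 U)
    (N : ℕ) {m : ℕ} (X : Fin (m + 1) → 𝒳) (u : ℕ → U) : ℝ :=
  ∑ n ∈ Finset.range N, ℓ m (microTraj hg X u n) (u n)

/-- The finite horizon value function `V_{N,M}(X)`. -/
def microValue {𝒳 U : Set ℝ} {g : Interaction 𝒳} (hg : StaysIn U g) (ℓ : RunningCost 𝒳 U)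
    (N : ℕ) {m : ℕ} (X : Fin (m + 1) → 𝒳) : ℝ :=
  ⨅ u : ℕ → U, microCost hg ℓ N X u

/-- The smallest running cost `ℓ*_M(X) = min_u ℓ_M(X, u)`. -/
def microMinCost {𝒳 U : Set ℝ} (ℓ : RunningCost 𝒳 U) {m : ℕ} (X : Fin (m + 1) → 𝒳) : ℝ :=
  ⨅ u : U, ℓ m X u

/-- Exponential controllability with `β(r, n) = C σ ^ n r`: every initial state admits a
control sequence with `ℓ_M(X_n, u_n) ≤ β(ℓ*_M(X_0), n)` for all `n`. -/
def ExpControllable {𝒳 U : Set ℝ} {g : Interaction 𝒳} (hg : StaysIn U g)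
    (ℓ : RunningCost 𝒳 U) (C σ : ℝ) (m : ℕ) : Prop :=
  ∀ X : Fin (m + 1) → 𝒳, ∃ u : ℕ → U, ∀ n : ℕ,
    ℓ m (microTraj hg X u n) (u n) ≤ C * σ ^ n * microMinCost ℓ X

/-- `κ` is an `N`-step MPC feedback: at each state it applies the first value of some
minimizer of the cost with horizon `N`. -/
def IsMPCFeedback {𝒳 U : Set ℝ} {g : Interaction 𝒳} (hg : StaysIn U g)
    (ℓ : RunningCost 𝒳 U) (N m : ℕ) (κ : (Fin (m + 1) → 𝒳) → U) : Prop :=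
  ∀ X : Fin (m + 1) → 𝒳, ∃ v : ℕ → U,
    (∀ w : ℕ → U, microCost hg ℓ N X v ≤ microCost hg ℓ N X w) ∧ κ X = v 0

/-! ## Mean-field limits along a subsequence -/

/-- `H` is the mean-field limit of the functions `h_M` along the subsequence `φ`. -/
def IsMeanFieldLimit {𝒳 : Set ℝ} (φ : ℕ → ℕ) (h : ∀ m : ℕ, (Fin (m + 1) → 𝒳) → ℝ)
    (H : ProbabilityMeasure 𝒳 → ℝ) : Prop :=
  Continuous H ∧ ∀ ε > 0, ∀ᶠ k in atTop, ∀ X : Fin (φ k + 1) → 𝒳,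
    |h (φ k) X - H (empirical X)| < ε

/-- The same for running costs, uniformly in the control value. -/
def IsMeanFieldLimitCost {𝒳 U : Set ℝ} (φ : ℕ → ℕ) (ℓ : RunningCost 𝒳 U)
    (L : ProbabilityMeasure 𝒳 → U → ℝ) : Prop :=
  Continuous (fun p : ProbabilityMeasure 𝒳 × U => L p.1 p.2) ∧
    ∀ ε > 0, ∀ᶠ k in atTop, ∀ (X : Fin (φ k + 1) → 𝒳) (u : U),
      |ℓ (φ k) X u - L (empirical X) u| < ε

/-- The same for interactions: `g(x_i, X_{-i})` is close to `G(x_i, ·)` at the empirical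
measure of the other agents. -/
def IsMeanFieldLimitInteraction {𝒳 : Set ℝ} (φ : ℕ → ℕ) (g : Interaction 𝒳)
    (G : 𝒳 → ProbabilityMeasure 𝒳 → ℝ) : Prop :=
  Continuous (fun p : 𝒳 × ProbabilityMeasure 𝒳 => G p.1 p.2) ∧
    ∀ ε > 0, ∀ᶠ k in atTop, ∀ [NeZero (φ k)] (x : 𝒳) (X : Fin (φ k) → 𝒳),
      |g (φ k) x X - G x (empirical X)| < ε

/-- `(G, L, μ)` are mean-field limits of `(g, ℓ_M, μ_M)` along the same subsequence. -/
structure AreMeanFieldLimits {𝒳 U : Set ℝ} (φ : ℕ → ℕ)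
    (g : Interaction 𝒳) (ℓ : RunningCost 𝒳 U) (μM : Feedback 𝒳 U)
    (G : 𝒳 → ProbabilityMeasure 𝒳 → ℝ) (L : ProbabilityMeasure 𝒳 → U → ℝ)
    (μ : ProbabilityMeasure 𝒳 → U) : Prop where
  interaction : IsMeanFieldLimitInteraction φ g G
  cost : IsMeanFieldLimitCost φ ℓ L
  feedback : IsMeanFieldLimit φ (fun m X => (μM m X : ℝ)) (fun f => (μ f : ℝ))

/-! ## The mean-field problem -/

/-- `F` is the mean-field trajectory issued from `f` under the control sequence `u`:
`F (n + 1)` is the image of `F n` under `x ↦ x + G(x, F n) + u_n`, that is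
`∫ ψ dF_{n+1} = ∫ ψ(x + G(x, F_n) + u_n) dF_n(x)`. -/
def IsMeanFieldTraj {𝒳 U : Set ℝ} (G : 𝒳 → ProbabilityMeasure 𝒳 → ℝ)
    (f : ProbabilityMeasure 𝒳) (u : ℕ → U) (F : ℕ → ProbabilityMeasure 𝒳) : Prop :=
  F 0 = f ∧ ∀ n : ℕ,
    (F (n + 1) : Measure 𝒳).map (fun x : 𝒳 => (x : ℝ)) =
      (F n : Measure 𝒳).map (fun x : 𝒳 => (x : ℝ) + G x (F n) + u n)

/-- The infinite horizon cost `∑ ℓ(f_n, u_n) ∈ [0, ∞]` of a trajectory. -/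
def mfInfCost {𝒳 U : Set ℝ} (L : ProbabilityMeasure 𝒳 → U → ℝ)
    (F : ℕ → ProbabilityMeasure 𝒳) (u : ℕ → U) : ℝ≥0∞ :=
  ∑' n : ℕ, ENNReal.ofReal (L (F n) (u n))

/-- The infinite horizon value function `V_∞`. -/
def mfInfValue {𝒳 U : Set ℝ} (G : 𝒳 → ProbabilityMeasure 𝒳 → ℝ)
    (L : ProbabilityMeasure 𝒳 → U → ℝ) (f : ProbabilityMeasure 𝒳) : ℝ≥0∞ :=
  sInf {J : ℝ≥0∞ | ∃ (u : ℕ → U) (F : ℕ → ProbabilityMeasure 𝒳),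
    IsMeanFieldTraj G f u F ∧ J = mfInfCost L F u}

/-- The finite horizon value function `V_N`. -/
def mfValue {𝒳 U : Set ℝ} (G : 𝒳 → ProbabilityMeasure 𝒳 → ℝ)
    (L : ProbabilityMeasure 𝒳 → U → ℝ) (N : ℕ) (f : ProbabilityMeasure 𝒳) : ℝ :=
  sInf {J : ℝ | ∃ (u : ℕ → U) (F : ℕ → ProbabilityMeasure 𝒳),
    IsMeanFieldTraj G f u F ∧ J = ∑ n ∈ Finset.range N, L (F n) (u n)}

end

end MeanFieldMPC

/-!
The relaxed dynamic programming inequality for `M` agents is the classical comparison argument for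
MPC without terminal conditions. Let `λ_n` be the running costs along a trajectory that is optimal
for horizon `N`, and `ν` the value at its second state. Following the optimal controls up to some
time and exponentially stabilizing ones afterwards gives admissible competitors, and comparing with
them yields exactly the linear inequalities of which `α` is a guaranteed consequence
(`microValue_microStep_add_le`). That consequence is assumed for positive numbers only, but the
inequalities are homogeneous and satisfied by `λ_n = σ ^ n`, `ν = σ + ⋯ + σ ^ N`, so a small multiple
of this solution can be added (`force_of_nonneg`).

For the mean-field part, `P(𝒳)` is compact and metrizable in the weak topology, `d₁` is continuous
on it (`continuous_d₁`) and empirical measures are dense (`exists_tendsto_empirical`, from the law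
of large numbers). Hence a common modulus of continuity in `d₁` allows an Arzelà–Ascoli extraction
of limits (`exists_subseq_uniform_limit`, `exists_areMeanFieldLimits`). All other convergence
statements are proved along arbitrary filters: if the empirical measures of the states and the
control values converge, then so do the successor states, the trajectories and the costs
(`IsMeanFieldLimitInteraction.tendsto_microStep`). The successor states of the `M`-agent and of the
mean-field system differ only through `g` versus `G` and through the removal of one agent from the
empirical measure, which is negligible as `M → ∞`. Compactness turns convergence along ultrafilters
into uniform convergence (`eventually_forall_abs_sub_lt`), which gives the convergence of the value
functions (`isMeanFieldLimit_microValue`). Approximating `f` by empirical measures, the dynamic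
programming inequality passes to the limit (`mfValue_mfStep_add_le`); telescoping it along the
closed loop and using `V_N ≥ 0` bounds the infinite horizon cost by `V_N(f) / α`.
-/

namespace MeanFieldMPC

/-! ### Empirical measures and the Kantorovich–Rubinstein distance -/

section

variable {𝒳 : Set ℝ}

theorem integral_empiricalMeasure {m : ℕ} (X : Fin m → 𝒳) (ψ : 𝒳 → ℝ) :
    ∫ x, ψ x ∂(empiricalMeasure X) = (m : ℝ)⁻¹ * ∑ i, ψ (X i) := by
  rw [empiricalMeasure, integral_smul_measure,
    integral_finsetSum_measure fun i _ => integrable_dirac (by simp)]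
  simp

theorem integral_empirical {m : ℕ} [NeZero m] (X : Fin m → 𝒳) (ψ : 𝒳 → ℝ) :
    ∫ x, ψ x ∂(empirical X : Measure 𝒳) = (m : ℝ)⁻¹ * ∑ i, ψ (X i) :=
  integral_empiricalMeasure X ψ

theorem integrable_continuousMap [CompactSpace 𝒳] (φ : C(𝒳, ℝ)) (p : Measure 𝒳)
    [IsFiniteMeasure p] : Integrable φ p :=
  (BoundedContinuousFunction.mkOfCompact φ).integrable p

theorem continuous_integral_continuousMap_prod [CompactSpace 𝒳] :
    Continuous fun q : ProbabilityMeasure 𝒳 × C(𝒳, ℝ) => ∫ x, q.2 x ∂(q.1 : Measure 𝒳) := by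
  rw [continuous_iff_continuousAt]
  rintro ⟨p₀, φ₀⟩
  have h1 : Tendsto (fun q : ProbabilityMeasure 𝒳 × C(𝒳, ℝ) => ∫ x, φ₀ x ∂(q.1 : Measure 𝒳))
      (𝓝 (p₀, φ₀)) (𝓝 (∫ x, φ₀ x ∂(p₀ : Measure 𝒳))) :=
    ((ProbabilityMeasure.continuous_integral_continuousMap φ₀).comp continuous_fst).tendsto _
  have h2 : Tendsto (fun q : ProbabilityMeasure 𝒳 × C(𝒳, ℝ) =>
      ∫ x, (q.2 - φ₀) x ∂(q.1 : Measure 𝒳)) (𝓝 (p₀, φ₀)) (𝓝 0) := by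
    have h3 : Tendsto (fun q : ProbabilityMeasure 𝒳 × C(𝒳, ℝ) => ‖q.2 - φ₀‖)
        (𝓝 (p₀, φ₀)) (𝓝 0) := by
      have : Continuous fun q : ProbabilityMeasure 𝒳 × C(𝒳, ℝ) => ‖q.2 - φ₀‖ := by fun_prop
      simpa using this.tendsto (p₀, φ₀)
    refine squeeze_zero_norm (fun q => ?_) h3
    simpa using norm_integral_le_of_norm_le_const (μ := (q.1 : Measure 𝒳))
      (Eventually.of_forall fun x => (q.2 - φ₀).norm_coe_le_norm x)
  have h := h1.add h2
  rw [add_zero] at h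
  refine h.congr fun q => ?_
  rw [← integral_add (integrable_continuousMap _ _) (integrable_continuousMap _ _)]
  simp

/-- By Arzelà–Ascoli, the `1`-Lipschitz functions vanishing at a given point form a compact set. -/
theorem isCompact_lipschitz_vanishing [CompactSpace 𝒳] (x₀ : 𝒳) :
    IsCompact {φ : C(𝒳, ℝ) | LipschitzWith 1 φ ∧ φ x₀ = 0} := by
  refine ArzelaAscoli.isCompact_of_equicontinuous _ ?_ ?_
  · have himage : (ContinuousMap.toFun '' {φ : C(𝒳, ℝ) | LipschitzWith 1 φ ∧ φ x₀ = 0}) =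
        {φ : 𝒳 → ℝ | (∀ x y, dist (φ x) (φ y) ≤ dist x y) ∧ φ x₀ = 0} := by
      ext φ
      constructor
      · rintro ⟨φ, ⟨h1, h2⟩, rfl⟩
        exact ⟨fun x y => by simpa using h1.dist_le_mul x y, h2⟩
      · rintro ⟨h1, h2⟩
        have hL : LipschitzWith 1 φ := LipschitzWith.of_dist_le_mul fun x y => by simpa using h1 x y
        exact ⟨⟨φ, hL.continuous⟩, ⟨hL, h2⟩, rfl⟩
    rw [himage]
    refine (isCompact_univ_pi fun x : 𝒳 => isCompact_Icc (a := -dist x x₀)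
      (b := dist x x₀)).of_isClosed_subset ?_ ?_
    · simp only [Set.ofPred_and, Set.ofPred_forall]
      exact (isClosed_iInter fun x => isClosed_iInter fun y => isClosed_le (by fun_prop)
        (by fun_prop)).inter (isClosed_eq (by fun_prop) (by fun_prop))
    · rintro φ ⟨h1, h2⟩ x -
      have := h1 x x₀
      rw [h2, Real.dist_eq, sub_zero] at this
      exact abs_le.1 this
  · refine Metric.equicontinuous_of_continuity_modulus id tendsto_id _ ?_
    rintro x y ⟨φ, h1, h2⟩
    simpa using h1.dist_le_mul x y

/-- The Kantorovich–Rubinstein distance is continuous for the weak topology, being a supremum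
over a compact set of test functions. -/
theorem continuous_d₁ [CompactSpace 𝒳] :
    Continuous fun p : ProbabilityMeasure 𝒳 × ProbabilityMeasure 𝒳 =>
      d₁ (p.1 : Measure 𝒳) (p.2 : Measure 𝒳) := by
  rcases isEmpty_or_nonempty 𝒳 with h | ⟨⟨x₀⟩⟩
  · have : IsEmpty (ProbabilityMeasure 𝒳) := ⟨fun p => h.elim p.nonempty.some⟩
    exact continuous_of_discreteTopology
  have hcont := (isCompact_lipschitz_vanishing x₀).continuous_sSup
    (f := fun (p : ProbabilityMeasure 𝒳 × ProbabilityMeasure 𝒳) (φ : C(𝒳, ℝ)) =>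
      ∫ x, φ x ∂(p.1 : Measure 𝒳) - ∫ x, φ x ∂(p.2 : Measure 𝒳)) (by
    have h1 := (continuous_integral_continuousMap_prod (𝒳 := 𝒳)).comp
      (f := fun q : (ProbabilityMeasure 𝒳 × ProbabilityMeasure 𝒳) × C(𝒳, ℝ) => (q.1.1, q.2))
      (by fun_prop)
    have h2 := (continuous_integral_continuousMap_prod (𝒳 := 𝒳)).comp
      (f := fun q : (ProbabilityMeasure 𝒳 × ProbabilityMeasure 𝒳) × C(𝒳, ℝ) => (q.1.2, q.2))
      (by fun_prop)
    exact h1.sub h2)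
  refine hcont.congr fun p => ?_
  rw [d₁]
  congr 1
  ext r
  constructor
  · rintro ⟨φ, hφ, rfl⟩
    exact ⟨φ, hφ.1, rfl⟩
  · rintro ⟨φ, hφ, rfl⟩
    -- subtracting the constant `φ x₀` changes both integrals by the same amount
    refine ⟨⟨φ, hφ.continuous⟩ - ContinuousMap.const _ (φ x₀), ⟨?_, by simp⟩, ?_⟩
    · exact LipschitzWith.of_dist_le_mul fun x y => by simpa using hφ.dist_le_mul x y
    · have h : ∀ q : ProbabilityMeasure 𝒳, ∫ x, (φ x - φ x₀) ∂(q : Measure 𝒳) =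
          ∫ x, φ x ∂(q : Measure 𝒳) - φ x₀ := fun q => by
        have hi : Integrable φ (q : Measure 𝒳) := integrable_continuousMap ⟨φ, hφ.continuous⟩ _
        rw [integral_sub hi (integrable_const _)]
        simp
      simp [h]

@[simp]
theorem d₁_self (μ : Measure 𝒳) : d₁ μ μ = 0 := by
  have : {r : ℝ | ∃ φ : 𝒳 → ℝ, LipschitzWith 1 φ ∧ r = ∫ x, φ x ∂μ - ∫ x, φ x ∂μ} = {0} := by
    ext r
    simp only [sub_self, Set.mem_ofPred_eq, Set.mem_singleton_iff]
    exact ⟨fun ⟨_, _, h⟩ => h, fun h => ⟨fun _ => 0, LipschitzWith.const' 0, h⟩⟩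
  rw [d₁, this, csSup_singleton]

theorem d₁_nonneg (μ ν : Measure 𝒳) : 0 ≤ d₁ μ ν := by
  by_cases h : BddAbove {r : ℝ | ∃ φ : 𝒳 → ℝ, LipschitzWith 1 φ ∧
      r = ∫ x, φ x ∂μ - ∫ x, φ x ∂ν}
  · exact le_csSup h ⟨fun _ => 0, LipschitzWith.const' 0, by simp⟩
  · rw [d₁, Real.sSup_of_not_bddAbove h]

/-- Every probability measure is a limit of empirical measures: by the strong law of large
numbers, almost every sequence of independent samples will do. -/
theorem exists_tendsto_empirical [CompactSpace 𝒳] (f : ProbabilityMeasure 𝒳) :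
    ∃ x : ℕ → 𝒳, ∀ (κ : ℕ → ℕ) [∀ k, NeZero (κ k)], Tendsto κ atTop atTop →
      Tendsto (fun k => empirical fun j : Fin (κ k) => x j) atTop (𝓝 f) := by
  set P : Measure (ℕ → 𝒳) := Measure.infinitePi fun _ => (f : Measure 𝒳) with hP
  have hlln : ∀ ψ : C(𝒳, ℝ), ∀ᵐ ω ∂P, Tendsto (fun n : ℕ => (∑ i ∈ Finset.range n, ψ (ω i)) / n)
      atTop (𝓝 (∫ x, ψ x ∂(f : Measure 𝒳))) := by
    intro ψ
    have hmeas : Measurable ψ := ψ.continuous.measurable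
    have hmap : ∀ i, P.map (fun ω : ℕ → 𝒳 => ω i) = (f : Measure 𝒳) := fun i =>
      Measure.infinitePi_map_eval (fun _ : ℕ => (f : Measure 𝒳)) i
    have h := ProbabilityTheory.strong_law_ae_real (μ := P) (fun i (ω : ℕ → 𝒳) => ψ (ω i)) ?_ ?_ ?_
    · have he : ∫ ω, ψ (ω 0) ∂P = ∫ x, ψ x ∂(f : Measure 𝒳) := by
        rw [← hmap 0, integral_map (measurable_pi_apply 0).aemeasurable
          (hmeas.aestronglyMeasurable)]
      rwa [he] at h
    · have hi : Integrable ψ (P.map fun ω : ℕ → 𝒳 => ω 0) := by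
        rw [hmap]
        exact integrable_continuousMap ψ _
      exact hi.comp_measurable (by fun_prop)
    · intro i j hij
      exact (ProbabilityTheory.iIndepFun_infinitePi (P := fun _ : ℕ => (f : Measure 𝒳))
        (X := fun _ x => ψ x) fun _ => hmeas).indepFun hij
    · intro i
      refine ⟨(hmeas.comp (measurable_pi_apply i)).aemeasurable,
        (hmeas.comp (measurable_pi_apply 0)).aemeasurable, ?_⟩
      have hc : ∀ j : ℕ, P.map (fun ω : ℕ → 𝒳 => ψ (ω j)) = (f : Measure 𝒳).map ψ := fun j => by
        rw [← hmap j, Measure.map_map hmeas (by fun_prop)]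
        rfl
      rw [hc, hc]
  obtain ⟨x, hx⟩ := (ae_all_iff.2 fun n => hlln (TopologicalSpace.denseSeq C(𝒳, ℝ) n)).exists
  refine ⟨x, fun κ _ hκ => ?_⟩
  rw [ProbabilityMeasure.tendsto_iff_forall_integral_tendsto]
  intro ψ
  rw [Metric.tendsto_nhds]
  intro ε hε
  obtain ⟨n, hn⟩ := (TopologicalSpace.denseRange_denseSeq C(𝒳, ℝ)).exists_dist_lt
    ψ.toContinuousMap (show 0 < ε / 3 by positivity)
  set χ := TopologicalSpace.denseSeq C(𝒳, ℝ) n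
  have hclose : ∀ p : ProbabilityMeasure 𝒳,
      dist (∫ y, ψ y ∂(p : Measure 𝒳)) (∫ y, χ y ∂(p : Measure 𝒳)) ≤ ε / 3 := by
    intro p
    rw [dist_eq_norm, ← integral_sub (ψ.integrable _)
      (integrable_continuousMap χ _)]
    refine (norm_integral_le_of_norm_le_const (C := ε / 3)
      (Eventually.of_forall fun y => ?_)).trans (by simp)
    have := (ContinuousMap.dist_apply_le_dist (f := ψ.toContinuousMap) (g := χ) y).trans hn.le
    simpa [dist_eq_norm] using this
  filter_upwards [(Metric.tendsto_nhds.1 ((hx n).comp hκ)) (ε / 3) (by positivity)] with i hi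
  have hi' : dist (∫ y, χ y ∂(empirical fun j : Fin (κ i) => x j : Measure 𝒳))
      (∫ y, χ y ∂(f : Measure 𝒳)) < ε / 3 := by
    rw [integral_empirical, Fin.sum_univ_eq_sum_range (fun j => χ (x j)), inv_mul_eq_div]
    exact hi
  have h1 := hclose (empirical fun j : Fin (κ i) => x j)
  have h2 := hclose f
  rw [dist_comm] at h2
  calc _ ≤ _ + _ + _ := dist_triangle4 _ _ _ _
    _ < ε / 3 + ε / 3 + ε / 3 := by
      have := add_lt_add_of_lt_of_le (add_lt_add_of_le_of_lt h1 hi') h2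
      exact this
    _ = ε := by ring

/-- Removing one agent does not change the limit of the empirical measures. The value `f` for
a system of one agent, which has no other agents, is immaterial. -/
theorem tendsto_empirical_others {ι : Type*} {l : Filter ι} {κ : ι → ℕ}
    (hκ : Tendsto κ l atTop) {X : ∀ i, Fin (κ i + 1) → 𝒳} {f : ProbabilityMeasure 𝒳}
    (hX : Tendsto (fun i => empirical (X i)) l (𝓝 f)) (j : ∀ i, Fin (κ i + 1)) :
    Tendsto (fun i => if h : κ i ≠ 0 then
      haveI : NeZero (κ i) := ⟨h⟩
      empirical (others (X i) (j i)) else f) l (𝓝 f) := by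
  rw [ProbabilityMeasure.tendsto_iff_forall_integral_tendsto] at hX ⊢
  intro ψ
  have hinv : Tendsto (fun i => (κ i : ℝ)⁻¹) l (𝓝 0) :=
    tendsto_inv_atTop_zero.comp (tendsto_natCast_atTop_atTop.comp hκ)
  have hsmall : Tendsto (fun i => (κ i : ℝ)⁻¹ *
      (∫ x, ψ x ∂(empirical (X i) : Measure 𝒳) - ψ (X i (j i)))) l (𝓝 0) := by
    refine squeeze_zero_norm (a := fun i => (κ i : ℝ)⁻¹ * (‖ψ‖ + ‖ψ‖)) (fun i => ?_)
      (by simpa using hinv.mul_const (‖ψ‖ + ‖ψ‖))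
    rw [norm_mul, norm_inv, Real.norm_natCast]
    gcongr
    refine (norm_sub_le _ _).trans (add_le_add ?_ (ψ.norm_coe_le_norm _))
    exact ψ.norm_integral_le_norm _
  have h := (hX ψ).add hsmall
  rw [add_zero] at h
  refine h.congr' ?_
  filter_upwards [hκ.eventually_ne_atTop 0] with i hi
  have : NeZero (κ i) := ⟨hi⟩
  have hi' : (κ i : ℝ) ≠ 0 := by exact_mod_cast hi
  rw [dif_pos hi, integral_empirical, integral_empirical, Fin.sum_univ_succAbove _ (j i)]
  simp only [others]
  push_cast
  field_simp
  ring

end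

/-! ### Uniform limits of functions on varying spaces -/

section

theorem eventually_forall_of_choice {ι : Type*} {β : ι → Type*} [∀ i, Nonempty (β i)]
    {l : Filter ι} {p : ∀ i, β i → Prop} (h : ∀ j : ∀ i, β i, ∀ᶠ i in l, p i (j i)) :
    ∀ᶠ i in l, ∀ b, p i b := by
  have hc : ∀ i, ∃ b : β i, (∃ b', ¬ p i b') → ¬ p i b := fun i => by
    by_cases hb : ∃ b', ¬ p i b'
    · exact ⟨hb.choose, fun _ => hb.choose_spec⟩
    · exact ⟨Classical.arbitrary _, fun h' => absurd h' hb⟩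
  choose j hj using hc
  filter_upwards [h j] with i hi
  by_contra! hb
  exact hj i hb hi

/-- Functions `h k` on `S k` are uniformly close to `H ∘ e k` as soon as `h` converges to the
value of `H` at the limit along every ultrafilter on the pairs `(k, s)` with `k → ∞` for which
the points `e k s` of the compact space converge. -/
theorem eventually_forall_abs_sub_lt {P : Type*} [TopologicalSpace P] [CompactSpace P]
    {S : ℕ → Type*} {e : ∀ k, S k → P} {h : ∀ k, S k → ℝ} {H : P → ℝ} (hH : Continuous H)
    (hlim : ∀ (l : Ultrafilter (Σ k, S k)) (p : P),
      Tendsto Sigma.fst (l : Filter (Σ k, S k)) atTop →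
      Tendsto (fun i : Σ k, S k => e i.1 i.2) l (𝓝 p) →
      Tendsto (fun i : Σ k, S k => h i.1 i.2) l (𝓝 (H p)))
    {ε : ℝ} (hε : 0 < ε) : ∀ᶠ k in atTop, ∀ s : S k, |h k s - H (e k s)| < ε := by
  by_contra hcon
  set bad : Set (Σ k, S k) := {i | ¬ |h i.1 i.2 - H (e i.1 i.2)| < ε} with hbad
  have hne : NeBot (comap Sigma.fst atTop ⊓ 𝓟 bad) := by
    rw [inf_principal_neBot_iff]
    rintro t ⟨t', ht', hsub⟩
    have hfr : ∃ᶠ k in atTop, ∃ s : S k, ¬ |h k s - H (e k s)| < ε := by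
      simpa only [Filter.Frequently, not_exists, not_not] using hcon
    obtain ⟨k, ⟨s, hs⟩, hk⟩ := (hfr.and_eventually ht').exists
    exact ⟨⟨k, s⟩, hsub hk, hs⟩
  set l := Ultrafilter.of (comap Sigma.fst atTop ⊓ 𝓟 bad)
  have hl : (l : Filter _) ≤ comap Sigma.fst atTop ⊓ 𝓟 bad := Ultrafilter.of_le _
  obtain ⟨p, -, hp⟩ := isCompact_univ.ultrafilter_le_nhds
    (l.map fun i : Σ k, S k => e i.1 i.2) (by simp)
  have hp' : Tendsto (fun i : Σ k, S k => e i.1 i.2) l (𝓝 p) := hp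
  have h1 := hlim l p (tendsto_iff_comap.2 (hl.trans inf_le_left)) hp'
  have h2 := (h1.sub ((hH.tendsto p).comp hp')).abs
  rw [sub_self, abs_zero] at h2
  have h3 : ∀ᶠ i in (l : Filter _), i ∈ bad := hl.trans inf_le_right (mem_principal_self _)
  obtain ⟨i, hi, hi'⟩ := (h3.and (h2.eventually (gt_mem_nhds hε))).exists
  exact hi hi'

/-- An Arzelà–Ascoli theorem for functions `h k` on varying spaces `S k` which are mapped
(asymptotically densely) into a separable compact space `P` by `e k`. The continuous function
`d`, vanishing on the diagonal, plays the role of a distance on `P`. -/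
theorem exists_subseq_uniform_limit {P : Type*} [TopologicalSpace P] [CompactSpace P]
    [TopologicalSpace.SeparableSpace P] {d : P → P → ℝ}
    (hd : Continuous fun q : P × P => d q.1 q.2) (hd₀ : ∀ p, d p p = 0)
    {S : ℕ → Type*} (e : ∀ k, S k → P) (h : ∀ k, S k → ℝ) {B : ℝ} (hB : ∀ k s, |h k s| ≤ B)
    (hequi : ∀ ε > 0, ∃ δ > 0, ∀ k s t, d (e k s) (e k t) < δ → |h k s - h k t| < ε)
    (hdense : ∀ p, ∃ s : ∀ k, S k, Tendsto (fun k => e k (s k)) atTop (𝓝 p)) :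
    ∃ θ : ℕ → ℕ, StrictMono θ ∧ ∃ H : P → ℝ, Continuous H ∧
      ∀ ε > 0, ∀ᶠ k in atTop, ∀ s : S (θ k), |h (θ k) s - H (e (θ k) s)| < ε := by
  choose s hs using hdense
  -- `h k (s p k)` approximates the value at `p` of the function to be constructed
  obtain ⟨D, hDc, hDd⟩ := TopologicalSpace.exists_countable_dense P
  have : Countable D := hDc
  obtain ⟨a, -, θ, hθ, hconv⟩ := (isCompact_univ_pi fun _ : D => isCompact_Icc (a := -B)
    (b := B)).tendsto_subseq (x := fun k (p : D) => h k (s p k))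
    fun k p _ => abs_le.1 (hB _ _)
  rw [tendsto_pi_nhds] at hconv
  have hsθ : ∀ p, Tendsto (fun k => e (θ k) (s p (θ k))) atTop (𝓝 p) := fun p =>
    (hs p).comp hθ.tendsto_atTop
  have hnear : ∀ {p q : P} {δ : ℝ}, d p q < δ →
      ∀ᶠ k in atTop, d (e (θ k) (s p (θ k))) (e (θ k) (s q (θ k))) < δ := fun hlt =>
    ((hd.tendsto (_, _)).comp ((hsθ _).prodMk_nhds (hsθ _))).eventually (gt_mem_nhds hlt)
  have hlim : ∀ p, ∃ c, Tendsto (fun k => h (θ k) (s p (θ k))) atTop (𝓝 c) := by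
    intro p
    refine cauchySeq_tendsto_of_complete (Metric.cauchySeq_iff'.2 fun ε hε => ?_)
    obtain ⟨δ, hδ, hδh⟩ := hequi (ε / 4) (by positivity)
    have hopen : IsOpen {q | d p q < δ} := isOpen_lt (hd.comp (Continuous.prodMk_right p))
      continuous_const
    obtain ⟨q, hqD, hq⟩ := hDd.exists_mem_open hopen ⟨p, by simpa [hd₀] using hδ⟩
    have h1 := (hnear hq).mono
      fun k hk => hδh _ _ _ hk
    have h2 := (Metric.tendsto_nhds.1 (hconv ⟨q, hqD⟩)) (ε / 4) (by positivity)
    obtain ⟨K, hK⟩ := eventually_atTop.1 (h1.and h2)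
    refine ⟨K, fun n hn => ?_⟩
    obtain ⟨hn1, hn2⟩ := hK n hn
    obtain ⟨hK1, hK2⟩ := hK K le_rfl
    simp only [Function.comp_apply, Real.dist_eq, abs_lt] at *
    constructor <;> linarith
  choose H hH using hlim
  have hHd : ∀ ε > 0, ∃ δ > 0, ∀ p q, d p q < δ → |H p - H q| ≤ ε := by
    intro ε hε
    obtain ⟨δ, hδ, hδh⟩ := hequi ε hε
    refine ⟨δ, hδ, fun p q hpq => ?_⟩
    exact le_of_tendsto ((hH p).sub (hH q)).abs
      ((hnear hpq).mono
        fun k hk => (hδh _ _ _ hk).le)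
  have hHc : Continuous H := by
    rw [continuous_iff_continuousAt]
    intro p
    refine Metric.tendsto_nhds.2 fun ε hε => ?_
    obtain ⟨δ, hδ, hδH⟩ := hHd (ε / 2) (by positivity)
    have hopen : IsOpen {q | d q p < δ} := isOpen_lt (hd.comp (Continuous.prodMk_left p))
      continuous_const
    filter_upwards [hopen.mem_nhds (show d p p < δ by simpa [hd₀] using hδ)] with q hq
    rw [Real.dist_eq]
    exact (hδH q p hq).trans_lt (by linarith)
  refine ⟨θ, hθ, H, hHc, fun ε hε => eventually_forall_abs_sub_lt (e := fun k => e (θ k))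
    (h := fun k => h (θ k)) hHc (fun l p hl hp => ?_) hε⟩
  rw [Metric.tendsto_nhds]
  intro ε hε
  obtain ⟨δ, hδ, hδh⟩ := hequi (ε / 2) (by positivity)
  have h1 := ((hd.tendsto (p, p)).comp (hp.prodMk_nhds ((hsθ p).comp hl))).eventually
    (gt_mem_nhds (show d p p < δ by simpa [hd₀] using hδ))
  filter_upwards [h1, (Metric.tendsto_nhds.1 ((hH p).comp hl)) (ε / 2) (by positivity)]
    with i hi1 hi2
  have := hδh _ _ _ hi1
  simp only [Function.comp_apply, Real.dist_eq, abs_lt] at *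
  constructor <;> linarith

end

/-! ### Relaxed dynamic programming for finitely many agents -/

section

variable {𝒳 U : Set ℝ} {g : Interaction 𝒳} {hg : StaysIn U g} {ℓ : RunningCost 𝒳 U} {m : ℕ}

theorem microTraj_add (X : Fin (m + 1) → 𝒳) (u : ℕ → U) (k n : ℕ) :
    microTraj hg X u (k + n) = microTraj hg (microTraj hg X u k) (fun i => u (k + i)) n := by
  induction n with
  | zero => rfl
  | succ n ih => rw [← add_assoc, microTraj, ih, microTraj]

theorem microTraj_congr (X : Fin (m + 1) → 𝒳) {u v : ℕ → U} {n : ℕ} (h : ∀ i < n, u i = v i) :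
    microTraj hg X u n = microTraj hg X v n := by
  induction n with
  | zero => rfl
  | succ n ih =>
    rw [microTraj, microTraj, ih fun i hi => h i (by omega), h n (by omega)]

/-- Follow `v` for `k` steps and `w` from then on. -/
def splice (v w : ℕ → U) (k : ℕ) : ℕ → U := fun n => if n < k then v n else w (n - k)

theorem microCost_splice (X : Fin (m + 1) → 𝒳) (v w : ℕ → U) (k K : ℕ) :
    microCost hg ℓ (k + K) X (splice v w k) =
      ∑ n ∈ Finset.range k, ℓ m (microTraj hg X v n) (v n)
        + microCost hg ℓ K (microTraj hg X v k) w := by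
  have hv : ∀ n ≤ k, microTraj hg X (splice v w k) n = microTraj hg X v n := fun n hn =>
    microTraj_congr X fun i hi => if_pos (by omega)
  rw [microCost, Finset.sum_range_add]
  congr 1
  · refine Finset.sum_congr rfl fun n hn => ?_
    have hn := Finset.mem_range.1 hn
    rw [hv n hn.le, splice, if_pos hn]
  · refine Finset.sum_congr rfl fun n _ => ?_
    have hw : (fun i => splice v w k (k + i)) = w := by
      funext i
      simp [splice]
    rw [microTraj_add, hv k le_rfl, hw, ← congrFun hw n]

theorem IsRegularCost.microCost_nonneg (hℓ : IsRegularCost ℓ) (N : ℕ) (X : Fin (m + 1) → 𝒳)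
    (u : ℕ → U) : 0 ≤ microCost hg ℓ N X u :=
  Finset.sum_nonneg fun _ _ => hℓ.nonneg _ _ _

theorem IsRegularCost.bddBelow_range_microCost (hℓ : IsRegularCost ℓ) (N : ℕ)
    (X : Fin (m + 1) → 𝒳) : BddBelow (Set.range fun u : ℕ → U => microCost hg ℓ N X u) :=
  ⟨0, by rintro _ ⟨u, rfl⟩; exact hℓ.microCost_nonneg N X u⟩

theorem ExpControllable.exists_microCost_le (hℓ : IsRegularCost ℓ) {C σ : ℝ} (hC : 0 ≤ C)
    (hσ₀ : 0 ≤ σ) (hσ₁ : σ < 1) (h : ExpControllable hg ℓ C σ m) (X : Fin (m + 1) → 𝒳) (u : U)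
    (K : ℕ) : ∃ w : ℕ → U,
      microCost hg ℓ K X w ≤ C * ℓ m X u * ((1 - σ ^ K) / (1 - σ)) := by
  obtain ⟨w, hw⟩ := h X
  have hmin : microMinCost ℓ X ≤ ℓ m X u :=
    ciInf_le ⟨0, by rintro _ ⟨v, rfl⟩; exact hℓ.nonneg m X v⟩ u
  refine ⟨w, ?_⟩
  calc microCost hg ℓ K X w ≤ ∑ n ∈ Finset.range K, C * ℓ m X u * σ ^ n :=
        Finset.sum_le_sum fun n _ => (hw n).trans <| by
          calc C * σ ^ n * microMinCost ℓ X ≤ C * σ ^ n * ℓ m X u := by gcongr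
            _ = _ := by ring
    _ = C * ℓ m X u * ((1 - σ ^ K) / (1 - σ)) := by
        rw [← Finset.mul_sum, geom_sum_eq hσ₁.ne, ← neg_div_neg_eq, neg_sub, neg_sub]

/-- The defining property of `α` extends from positive to nonnegative numbers: the constraints
are linear, and they hold for the perturbations `lam n + ε σ ^ n` and `ν + ε (σ + ⋯ + σ ^ N)`. -/
theorem force_of_nonneg {C σ α : ℝ} (hC : 1 ≤ C) (hσ₀ : 0 < σ) (hσ₁ : σ < 1) {N : ℕ} (hN : 2 ≤ N)
    (hforce : ∀ (lam : ℕ → ℝ) (ν : ℝ), (∀ n < N, 0 < lam n) → 0 < ν →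
      (∀ k : ℕ, k + 2 ≤ N →
        ∑ n ∈ Finset.Ico k N, lam n ≤ C * lam k * ((1 - σ ^ (N - k)) / (1 - σ))) →
      (∀ j : ℕ, j + 2 ≤ N →
        ν ≤ ∑ n ∈ Finset.range j, lam (n + 1)
          + C * lam (j + 1) * ((1 - σ ^ (N - j)) / (1 - σ))) →
      lam 0 * α ≤ ∑ n ∈ Finset.range N, lam n - ν)
    {lam : ℕ → ℝ} {ν : ℝ} (hlam : ∀ n, 0 ≤ lam n) (hν : 0 ≤ ν)
    (h1 : ∀ k : ℕ, k + 2 ≤ N →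
      ∑ n ∈ Finset.Ico k N, lam n ≤ C * lam k * ((1 - σ ^ (N - k)) / (1 - σ)))
    (h2 : ∀ j : ℕ, j + 2 ≤ N →
      ν ≤ ∑ n ∈ Finset.range j, lam (n + 1)
        + C * lam (j + 1) * ((1 - σ ^ (N - j)) / (1 - σ))) :
    lam 0 * α ≤ ∑ n ∈ Finset.range N, lam n - ν := by
  have hgeom : ∀ K : ℕ, ∑ n ∈ Finset.range K, σ ^ n = (1 - σ ^ K) / (1 - σ) := fun K => by
    rw [geom_sum_eq hσ₁.ne, ← neg_div_neg_eq, neg_sub, neg_sub]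
  set ν₀ : ℝ := ∑ n ∈ Finset.range N, σ ^ (n + 1) with hν₀
  have hν₀pos : 0 < ν₀ := Finset.sum_pos (fun n _ => by positivity) ⟨0, by simp; omega⟩
  have key : ∀ ε > 0, (lam 0 + ε * σ ^ 0) * α ≤
      ∑ n ∈ Finset.range N, (lam n + ε * σ ^ n) - (ν + ε * ν₀) := by
    intro ε hε
    refine hforce (fun n => lam n + ε * σ ^ n) (ν + ε * ν₀)
      (fun n _ => add_pos_of_nonneg_of_pos (hlam n) (by positivity)) (by positivity) ?_ ?_
    · intro k hk
      have hs : ∑ n ∈ Finset.Ico k N, σ ^ n = σ ^ k * ((1 - σ ^ (N - k)) / (1 - σ)) := by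
        rw [Finset.sum_Ico_eq_sum_range, ← hgeom, Finset.mul_sum]
        simp only [pow_add]
      have hp : 0 ≤ σ ^ k * ((1 - σ ^ (N - k)) / (1 - σ)) := by
        rw [← hgeom]
        positivity
      rw [Finset.sum_add_distrib, ← Finset.mul_sum, hs]
      have := h1 k hk
      have h3 := mul_le_mul_of_nonneg_right hC (mul_nonneg hε.le hp)
      linear_combination this + h3
    · intro j hj
      have hs : ν₀ = ∑ n ∈ Finset.range j, σ ^ (n + 1)
          + σ ^ (j + 1) * ((1 - σ ^ (N - j)) / (1 - σ)) := by
        obtain ⟨K, rfl⟩ : ∃ K, N = j + K := ⟨N - j, by omega⟩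
        rw [hν₀, Finset.sum_range_add, ← hgeom, Finset.mul_sum, Nat.add_sub_cancel_left]
        congr 1
        exact Finset.sum_congr rfl fun n _ => by ring
      have hp : 0 ≤ σ ^ (j + 1) * ((1 - σ ^ (N - j)) / (1 - σ)) := by
        rw [← hgeom]
        positivity
      rw [Finset.sum_add_distrib, ← Finset.mul_sum, hs]
      have := h2 j hj
      have h3 := mul_le_mul_of_nonneg_right hC (mul_nonneg hε.le hp)
      linear_combination this + h3
  have hL : Tendsto (fun ε : ℝ => (lam 0 + ε * σ ^ 0) * α) (𝓝[>] 0) (𝓝 (lam 0 * α)) := by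
    have : Continuous fun ε : ℝ => (lam 0 + ε * σ ^ 0) * α := by fun_prop
    simpa using (this.tendsto 0).mono_left nhdsWithin_le_nhds
  have hR : Tendsto (fun ε : ℝ => ∑ n ∈ Finset.range N, (lam n + ε * σ ^ n) - (ν + ε * ν₀))
      (𝓝[>] 0) (𝓝 (∑ n ∈ Finset.range N, lam n - ν)) := by
    have : Continuous fun ε : ℝ => ∑ n ∈ Finset.range N, (lam n + ε * σ ^ n) - (ν + ε * ν₀) := by
      fun_prop
    simpa using (this.tendsto 0).mono_left nhdsWithin_le_nhds
  exact le_of_tendsto_of_tendsto hL hR (eventually_mem_nhdsWithin.mono key)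

/-- The relaxed dynamic programming inequality. Along an optimal trajectory, the tails of the
cost and the value at the second state are bounded by comparison with the controls which follow
the optimal one for a while and then the exponentially stabilizing one. -/
theorem microValue_microStep_add_le (hℓ : IsRegularCost ℓ) {C σ α : ℝ} (hC : 1 ≤ C) (hσ₀ : 0 < σ)
    (hσ₁ : σ < 1) {N : ℕ} (hN : 2 ≤ N)
    (hforce : ∀ (lam : ℕ → ℝ) (ν : ℝ), (∀ n < N, 0 < lam n) → 0 < ν →
      (∀ k : ℕ, k + 2 ≤ N →
        ∑ n ∈ Finset.Ico k N, lam n ≤ C * lam k * ((1 - σ ^ (N - k)) / (1 - σ))) →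
      (∀ j : ℕ, j + 2 ≤ N →
        ν ≤ ∑ n ∈ Finset.range j, lam (n + 1)
          + C * lam (j + 1) * ((1 - σ ^ (N - j)) / (1 - σ))) →
      lam 0 * α ≤ ∑ n ∈ Finset.range N, lam n - ν)
    {κ : (Fin (m + 1) → 𝒳) → U} (hctrl : ExpControllable hg ℓ C σ m)
    (hκ : IsMPCFeedback hg ℓ N m κ) (X : Fin (m + 1) → 𝒳) :
    microValue hg ℓ N (microStep hg X (κ X)) + α * ℓ m X (κ X) ≤ microValue hg ℓ N X := by
  obtain ⟨v, hv, hv0⟩ := hκ X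
  have : Nonempty U := ⟨κ X⟩
  have hopt : microValue hg ℓ N X = microCost hg ℓ N X v :=
    le_antisymm (ciInf_le (hℓ.bddBelow_range_microCost N X) v) (le_ciInf hv)
  have hX1 : microStep hg X (κ X) = microTraj hg X v 1 := by rw [hv0]; rfl
  have hC0 : 0 ≤ C := by linarith
  have := force_of_nonneg hC hσ₀ hσ₁ hN hforce
    (lam := fun n => ℓ m (microTraj hg X v n) (v n)) (ν := microValue hg ℓ N (microTraj hg X v 1))
    (fun n => hℓ.nonneg _ _ _) (le_ciInf fun u => hℓ.microCost_nonneg N _ u) ?_ ?_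
  · rw [hX1, hopt]
    have h0 : ℓ m X (κ X) = ℓ m (microTraj hg X v 0) (v 0) := by rw [hv0]; rfl
    rw [h0]
    simp only [microCost]
    linarith
  · intro k hk
    obtain ⟨w, hw⟩ := hctrl.exists_microCost_le hℓ hC0 hσ₀.le hσ₁ (microTraj hg X v k) (v k) (N - k)
    have h1 := hv (splice v w k)
    have h2 := microCost_splice (hg := hg) (ℓ := ℓ) X v w k (N - k)
    rw [Nat.add_sub_cancel' (by omega)] at h2
    rw [h2, microCost, ← Finset.sum_range_add_sum_Ico _ (show k ≤ N by omega)] at h1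
    linarith
  · intro j hj
    obtain ⟨w, hw⟩ := hctrl.exists_microCost_le hℓ hC0 hσ₀.le hσ₁ (microTraj hg X v (j + 1))
      (v (j + 1)) (N - j)
    have hshift : ∀ n, microTraj hg (microTraj hg X v 1) (fun i => v (i + 1)) n =
        microTraj hg X v (n + 1) := fun n => by
      have := microTraj_add (hg := hg) X v 1 n
      simp only [add_comm 1] at this
      exact this.symm
    have h1 := ciInf_le (hℓ.bddBelow_range_microCost (hg := hg) N (microTraj hg X v 1))
      (splice (fun i => v (i + 1)) w j)
    have h2 := microCost_splice (hg := hg) (ℓ := ℓ) (microTraj hg X v 1) (fun i => v (i + 1)) w j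
      (N - j)
    rw [Nat.add_sub_cancel' (by omega)] at h2
    rw [h2] at h1
    simp only [hshift] at h1
    exact h1.trans (by linarith)

end

/-! ### Mean-field dynamics as a limit of microscopic dynamics -/

section

variable {𝒳 U : Set ℝ} {g : Interaction 𝒳} {hg : StaysIn U g} {ℓ : RunningCost 𝒳 U}
  {G : 𝒳 → ProbabilityMeasure 𝒳 → ℝ} {L : ProbabilityMeasure 𝒳 → U → ℝ} {φ : ℕ → ℕ}

/-- `𝒳` is invariant under the mean-field dynamics. -/
def MFStaysIn (U : Set ℝ) (G : 𝒳 → ProbabilityMeasure 𝒳 → ℝ) : Prop :=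
  ∀ (x : 𝒳) (f : ProbabilityMeasure 𝒳) (u : U), (x : ℝ) + G x f + u ∈ 𝒳

/-- Close to the limit, all agents of a large system feel almost the limiting interaction. -/
theorem IsMeanFieldLimitInteraction.eventually_forall [CompactSpace 𝒳]
    (hG : IsMeanFieldLimitInteraction φ g G) (hφ : StrictMono φ) {ι : Type*} {l : Filter ι}
    {k : ι → ℕ} (hk : Tendsto k l atTop) {X : ∀ i, Fin (φ (k i) + 1) → 𝒳}
    {f : ProbabilityMeasure 𝒳} (hX : Tendsto (fun i => empirical (X i)) l (𝓝 f))
    {ε : ℝ} (hε : 0 < ε) :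
    ∀ᶠ i in l, ∀ j, |g (φ (k i)) (X i j) (others (X i) j) - G (X i j) f| < ε := by
  refine eventually_forall_of_choice fun j => ?_
  have hφk : Tendsto (fun i => φ (k i)) l atTop := hφ.tendsto_atTop.comp hk
  have hunif : ∀ᶠ f' in 𝓝 f, ∀ x, |G x f' - G x f| < ε / 2 := by
    have hc : Continuous fun f' : ProbabilityMeasure 𝒳 =>
        (ContinuousMap.mk (fun q : ProbabilityMeasure 𝒳 × 𝒳 => G q.2 q.1)
          (hG.1.comp continuous_swap)).curry f' := ContinuousMap.continuous _
    filter_upwards [Metric.tendsto_nhds.1 (hc.tendsto f) (ε / 2) (by positivity)] with f' hf' x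
    exact (ContinuousMap.dist_apply_le_dist x).trans_lt hf'
  filter_upwards [hk.eventually (hG.2 (ε / 2) (by positivity)), hφk.eventually_ne_atTop 0,
    (tendsto_empirical_others hφk hX j).eventually hunif] with i h1 h0 h2
  have : NeZero (φ (k i)) := ⟨h0⟩
  rw [dif_pos h0] at h2
  have h1 := h1 (X i (j i)) (others (X i) (j i))
  have h2 := h2 (X i (j i))
  rw [abs_lt] at *
  constructor <;> linarith

/-- Invariance of `𝒳` passes to the limit: `x` is placed among agents whose empirical measure
tends to `f`, and `𝒳` is closed. -/
theorem IsMeanFieldLimitInteraction.mfStaysIn [CompactSpace 𝒳]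
    (hG : IsMeanFieldLimitInteraction φ g G) (hφ : StrictMono φ) (hg : StaysIn U g) :
    MFStaysIn U G := by
  intro x f u
  obtain ⟨y, hy⟩ := exists_tendsto_empirical f
  have hshift : Tendsto (fun k => φ (k + 1)) atTop atTop :=
    hφ.tendsto_atTop.comp (tendsto_add_atTop_nat 1)
  have : ∀ k, NeZero (φ (k + 1)) := fun k => ⟨(hφ (Nat.succ_pos k)).ne_bot⟩
  have h1 : Tendsto (fun k => g (φ (k + 1)) x fun j => y j) atTop (𝓝 (G x f)) := by
    have h2 := (hG.1.comp (Continuous.prodMk_right x)).tendsto f |>.comp (hy _ hshift)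
    have h3 : Tendsto (fun k => g (φ (k + 1)) x (fun j => y j) -
        G x (empirical fun j : Fin (φ (k + 1)) => y j)) atTop (𝓝 0) := by
      refine Metric.tendsto_nhds.2 fun ε hε => ?_
      filter_upwards [(tendsto_add_atTop_nat 1).eventually (hG.2 ε hε)] with k hk
      simpa [Real.dist_eq] using hk x fun j => y j
    simpa using h3.add h2
  have hclosed : IsClosed 𝒳 := (isCompact_iff_compactSpace.2 inferInstance).isClosed
  refine hclosed.mem_of_tendsto ((h1.const_add (x : ℝ)).add_const (u : ℝ))
    (Eventually.of_forall fun k => ?_)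
  exact hg (φ (k + 1)) (Fin.cons x fun j => y j) u 0

/-- The map `x ↦ x + G(x, f) + u` of `𝒳` into itself, bundled with its continuity. -/
def mfMap (hG : Continuous fun q : 𝒳 × ProbabilityMeasure 𝒳 => G q.1 q.2) (hin : MFStaysIn U G)
    (f : ProbabilityMeasure 𝒳) (u : U) : C(𝒳, 𝒳) :=
  ⟨fun x => ⟨(x : ℝ) + G x f + u, hin x f u⟩, by
    have : Continuous fun x => G x f := hG.comp (Continuous.prodMk_left f)
    fun_prop⟩

/-- One step of the mean-field dynamics. -/
noncomputable def mfStep (hG : Continuous fun q : 𝒳 × ProbabilityMeasure 𝒳 => G q.1 q.2)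
    (hin : MFStaysIn U G) (f : ProbabilityMeasure 𝒳) (u : U) : ProbabilityMeasure 𝒳 :=
  f.map (f := mfMap hG hin f u) (mfMap hG hin f u).continuous.measurable.aemeasurable

/-- The mean-field trajectory. -/
noncomputable def mfTraj (hG : Continuous fun q : 𝒳 × ProbabilityMeasure 𝒳 => G q.1 q.2)
    (hin : MFStaysIn U G) (f : ProbabilityMeasure 𝒳) (u : ℕ → U) : ℕ → ProbabilityMeasure 𝒳
  | 0 => f
  | n + 1 => mfStep hG hin (mfTraj hG hin f u n) (u n)

section

variable {hG : Continuous fun q : 𝒳 × ProbabilityMeasure 𝒳 => G q.1 q.2} {hin : MFStaysIn U G}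

/-- Measures on `𝒳` are determined by their images in `ℝ`, so that the equation between measures
on `ℝ` which defines mean-field trajectories is an explicit recursion in `P(𝒳)`. -/
theorem eq_mfStep_iff (p f : ProbabilityMeasure 𝒳) (u : U) :
    (p : Measure 𝒳).map (fun x : 𝒳 => (x : ℝ)) =
      (f : Measure 𝒳).map (fun x : 𝒳 => (x : ℝ) + G x f + u) ↔ p = mfStep hG hin f u := by
  have hinj : ∀ p q : ProbabilityMeasure 𝒳, (p : Measure 𝒳).map (fun x : 𝒳 => (x : ℝ)) =
      (q : Measure 𝒳).map (fun x : 𝒳 => (x : ℝ)) → p = q := by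
    intro p q h
    refine Subtype.ext (Measure.ext fun s hs => ?_)
    obtain ⟨t, ht, rfl⟩ := hs
    have h2 := congrArg (fun ρ : Measure ℝ => ρ t) h
    simpa [Measure.map_apply measurable_subtype_coe ht] using h2
  have hmap : ((mfStep hG hin f u : ProbabilityMeasure 𝒳) : Measure 𝒳).map (fun x : 𝒳 => (x : ℝ)) =
      (f : Measure 𝒳).map (fun x : 𝒳 => (x : ℝ) + G x f + u) := by
    rw [mfStep, ProbabilityMeasure.toMeasure_map,
      Measure.map_map measurable_subtype_coe (mfMap hG hin f u).continuous.measurable]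
    rfl
  rw [← hmap]
  exact ⟨hinj _ _, fun h => by rw [h]⟩

theorem isMeanFieldTraj_iff {f : ProbabilityMeasure 𝒳} {u : ℕ → U}
    {F : ℕ → ProbabilityMeasure 𝒳} : IsMeanFieldTraj G f u F ↔
      F 0 = f ∧ ∀ n, F (n + 1) = mfStep hG hin (F n) (u n) := by
  simp only [IsMeanFieldTraj, eq_mfStep_iff (hG := hG) (hin := hin)]

theorem isMeanFieldTraj_iff_eq_mfTraj {f : ProbabilityMeasure 𝒳} {u : ℕ → U}
    {F : ℕ → ProbabilityMeasure 𝒳} : IsMeanFieldTraj G f u F ↔ F = mfTraj hG hin f u := by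
  rw [isMeanFieldTraj_iff (hG := hG) (hin := hin)]
  constructor
  · rintro ⟨h0, h⟩
    funext n
    induction n with
    | zero => exact h0
    | succ n ih => rw [h, ih, mfTraj]
  · rintro rfl
    exact ⟨rfl, fun n => rfl⟩

theorem existsUnique_isMeanFieldTraj_feedback (hG : Continuous fun q : 𝒳 × ProbabilityMeasure 𝒳 =>
    G q.1 q.2) (hin : MFStaysIn U G) (f : ProbabilityMeasure 𝒳) (μ : ProbabilityMeasure 𝒳 → U) :
    ∃! F : ℕ → ProbabilityMeasure 𝒳, IsMeanFieldTraj G f (fun n => μ (F n)) F := by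
  simp only [isMeanFieldTraj_iff (hG := hG) (hin := hin)]
  refine ⟨fun n => Nat.rec f (fun _ p => mfStep hG hin p (μ p)) n, ⟨rfl, fun n => rfl⟩, ?_⟩
  rintro F ⟨h0, h⟩
  funext n
  induction n with
  | zero => exact h0
  | succ n ih => rw [h, ih]

theorem integral_mfStep (f : ProbabilityMeasure 𝒳) (u : U) (ψ : C(𝒳, ℝ)) :
    ∫ x, ψ x ∂(mfStep hG hin f u : Measure 𝒳) =
      ∫ x, ψ (mfMap hG hin f u x) ∂(f : Measure 𝒳) := by
  rw [mfStep, ProbabilityMeasure.toMeasure_map, integral_map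
    (mfMap hG hin f u).continuous.measurable.aemeasurable
    ψ.continuous.measurable.aestronglyMeasurable]

theorem continuous_mfStep [CompactSpace 𝒳] : Continuous fun q : ProbabilityMeasure 𝒳 × U =>
    mfStep hG hin q.1 q.2 := by
  rw [ProbabilityMeasure.continuous_iff_forall_continuousMap_continuous_integral]
  intro ψ
  simp only [integral_mfStep]
  have hc : Continuous fun q : (ProbabilityMeasure 𝒳 × U) × 𝒳 =>
      ψ (mfMap hG hin q.1.1 q.1.2 q.2) := by
    have : Continuous fun q : (ProbabilityMeasure 𝒳 × U) × 𝒳 => G q.2 q.1.1 :=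
      hG.comp (by fun_prop : Continuous fun q : (ProbabilityMeasure 𝒳 × U) × 𝒳 => (q.2, q.1.1))
    refine ψ.continuous.comp (Continuous.subtype_mk ?_ _)
    fun_prop
  exact continuous_integral_continuousMap_prod.comp
    (continuous_fst.prodMk (ContinuousMap.continuous (ContinuousMap.curry ⟨_, hc⟩)))

theorem continuous_mfTraj [CompactSpace 𝒳] (n : ℕ) :
    Continuous fun q : ProbabilityMeasure 𝒳 × (ℕ → U) => mfTraj hG hin q.1 q.2 n := by
  induction n with
  | zero => exact continuous_fst
  | succ n ih =>
    exact continuous_mfStep.comp (ih.prodMk ((continuous_apply n).comp continuous_snd))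

/-- The microscopic dynamics converges to the mean-field dynamics, in one step. -/
theorem IsMeanFieldLimitInteraction.tendsto_microStep [CompactSpace 𝒳]
    (hlim : IsMeanFieldLimitInteraction φ g G)
    (hφ : StrictMono φ) {ι : Type*} {l : Filter ι} {k : ι → ℕ} (hk : Tendsto k l atTop)
    {X : ∀ i, Fin (φ (k i) + 1) → 𝒳} {f : ProbabilityMeasure 𝒳}
    (hX : Tendsto (fun i => empirical (X i)) l (𝓝 f)) {u : ι → U} {v : U}
    (hu : Tendsto u l (𝓝 v)) :
    Tendsto (fun i => empirical (microStep hg (X i) (u i))) l (𝓝 (mfStep hG hin f v)) := by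
  rw [ProbabilityMeasure.tendsto_iff_forall_integral_tendsto]
  intro ψ
  have h1 := ProbabilityMeasure.tendsto_iff_forall_integral_tendsto.1 hX
    (BoundedContinuousFunction.mkOfCompact
    (ψ.toContinuousMap.comp (mfMap hG hin f v)))
  have h2 : Tendsto (fun i => ∫ x, ψ x ∂(empirical (microStep hg (X i) (u i)) : Measure 𝒳) -
      ∫ x, ψ (mfMap hG hin f v x) ∂(empirical (X i) : Measure 𝒳)) l (𝓝 0) := by
    refine Metric.tendsto_nhds.2 fun ε hε => ?_
    obtain ⟨δ, hδ, hψ⟩ := Metric.uniformContinuous_iff.1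
      (CompactSpace.uniformContinuous_of_continuous ψ.continuous) (ε / 2) (by positivity)
    filter_upwards [hlim.eventually_forall hφ hk hX (half_pos hδ),
      Metric.tendsto_nhds.1 hu (δ / 2) (by positivity)] with i hi1 hi2
    have hle : ∀ j, |ψ (microStep hg (X i) (u i) j) - ψ (mfMap hG hin f v (X i j))| ≤ ε / 2 := by
      intro j
      refine (hψ (a := microStep hg (X i) (u i) j) (b := mfMap hG hin f v (X i j)) ?_).le
      have h3 := hi1 j
      rw [Subtype.dist_eq, Real.dist_eq, abs_lt] at hi2 ⊢
      rw [abs_lt] at h3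
      simp only [microStep, mfMap, ContinuousMap.coe_mk]
      constructor <;> linarith
    rw [dist_zero_right, integral_empirical, integral_empirical, ← mul_sub,
      ← Finset.sum_sub_distrib, norm_mul]
    have hsum : ‖∑ j, (ψ (microStep hg (X i) (u i) j) - ψ (mfMap hG hin f v (X i j)))‖ ≤
        (φ (k i) + 1 : ℕ) * (ε / 2) :=
      (norm_sum_le_of_le _ fun j _ => hle j).trans (by simp)
    calc _ ≤ ‖((φ (k i) + 1 : ℕ) : ℝ)⁻¹‖ * ((φ (k i) + 1 : ℕ) * (ε / 2)) := by gcongr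
      _ = ε / 2 := by
        rw [norm_inv, Real.norm_natCast, inv_mul_cancel_left₀ (by positivity)]
      _ < ε := by linarith
  have h3 := h2.add h1
  have he : ∫ x, ψ x ∂(mfStep hG hin f v : Measure 𝒳) =
      ∫ x, ψ (mfMap hG hin f v x) ∂(f : Measure 𝒳) := integral_mfStep f v ψ.toContinuousMap
  rw [zero_add] at h3
  rw [he]
  refine h3.congr fun i => ?_
  simp

theorem IsMeanFieldLimitInteraction.tendsto_microTraj [CompactSpace 𝒳]
    (hlim : IsMeanFieldLimitInteraction φ g G)
    (hφ : StrictMono φ) {ι : Type*} {l : Filter ι} {k : ι → ℕ} (hk : Tendsto k l atTop)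
    {X : ∀ i, Fin (φ (k i) + 1) → 𝒳} {f : ProbabilityMeasure 𝒳}
    (hX : Tendsto (fun i => empirical (X i)) l (𝓝 f)) {u : ι → ℕ → U} {v : ℕ → U}
    (hu : Tendsto u l (𝓝 v)) (n : ℕ) :
    Tendsto (fun i => empirical (microTraj hg (X i) (u i) n)) l (𝓝 (mfTraj hG hin f v n)) := by
  induction n with
  | zero => exact hX
  | succ n ih => exact hlim.tendsto_microStep hφ hk ih (tendsto_pi_nhds.1 hu n)

theorem IsMeanFieldLimitCost.tendsto (hL : IsMeanFieldLimitCost φ ℓ L) {ι : Type*} {l : Filter ι}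
    {k : ι → ℕ} (hk : Tendsto k l atTop) {X : ∀ i, Fin (φ (k i) + 1) → 𝒳}
    {f : ProbabilityMeasure 𝒳} (hX : Tendsto (fun i => empirical (X i)) l (𝓝 f)) {u : ι → U}
    {v : U} (hu : Tendsto u l (𝓝 v)) :
    Tendsto (fun i => ℓ (φ (k i)) (X i) (u i)) l (𝓝 (L f v)) := by
  have h1 := (hL.1.tendsto (f, v)).comp (hX.prodMk_nhds hu)
  have h2 : Tendsto (fun i => ℓ (φ (k i)) (X i) (u i) - L (empirical (X i)) (u i)) l (𝓝 0) := by
    refine Metric.tendsto_nhds.2 fun ε hε => ?_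
    filter_upwards [hk.eventually (hL.2 ε hε)] with i hi
    simpa [Real.dist_eq] using hi (X i) (u i)
  simpa using h2.add h1

theorem IsMeanFieldLimit.tendsto {h : ∀ m : ℕ, (Fin (m + 1) → 𝒳) → ℝ}
    {H : ProbabilityMeasure 𝒳 → ℝ} (hH : IsMeanFieldLimit φ h H) {ι : Type*} {l : Filter ι}
    {k : ι → ℕ} (hk : Tendsto k l atTop) {X : ∀ i, Fin (φ (k i) + 1) → 𝒳}
    {f : ProbabilityMeasure 𝒳} (hX : Tendsto (fun i => empirical (X i)) l (𝓝 f)) :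
    Tendsto (fun i => h (φ (k i)) (X i)) l (𝓝 (H f)) := by
  have h1 := (hH.1.tendsto f).comp hX
  have h2 : Tendsto (fun i => h (φ (k i)) (X i) - H (empirical (X i))) l (𝓝 0) := by
    refine Metric.tendsto_nhds.2 fun ε hε => ?_
    filter_upwards [hk.eventually (hH.2 ε hε)] with i hi
    simpa [Real.dist_eq] using hi (X i)
  simpa using h2.add h1

end

/-- The mean-field cost with horizon `N`, as a function of initial state and controls. -/
noncomputable def mfCost (hG : Continuous fun q : 𝒳 × ProbabilityMeasure 𝒳 => G q.1 q.2)
    (hin : MFStaysIn U G) (L : ProbabilityMeasure 𝒳 → U → ℝ) (N : ℕ) (f : ProbabilityMeasure 𝒳)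
    (u : ℕ → U) : ℝ :=
  ∑ n ∈ Finset.range N, L (mfTraj hG hin f u n) (u n)

theorem mfValue_eq (hG : Continuous fun q : 𝒳 × ProbabilityMeasure 𝒳 => G q.1 q.2)
    (hin : MFStaysIn U G) (N : ℕ) (f : ProbabilityMeasure 𝒳) :
    mfValue G L N f = ⨅ u : ℕ → U, mfCost hG hin L N f u := by
  rw [mfValue, iInf]
  congr 1
  ext J
  simp only [isMeanFieldTraj_iff_eq_mfTraj (hG := hG) (hin := hin), exists_eq_left]
  exact ⟨fun ⟨u, h⟩ => ⟨u, h.symm⟩, fun ⟨u, h⟩ => ⟨u, h.symm⟩⟩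

/-- The value functions converge to the mean-field value function. -/
theorem isMeanFieldLimit_microValue [CompactSpace 𝒳] [CompactSpace U] [Nonempty U]
    (hℓ : IsRegularCost ℓ) (hφ : StrictMono φ) (hlim : IsMeanFieldLimitInteraction φ g G)
    (hL : IsMeanFieldLimitCost φ ℓ L) (hL₀ : ∀ f u, 0 ≤ L f u) (N : ℕ) :
    IsMeanFieldLimit φ (fun _ X => microValue hg ℓ N X) (mfValue G L N) := by
  have hin := hlim.mfStaysIn hφ hg
  have hcost : Continuous fun q : ProbabilityMeasure 𝒳 × (ℕ → U) =>
      mfCost hlim.1 hin L N q.1 q.2 :=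
    continuous_finsetSum _ fun n _ => hL.1.comp
      ((continuous_mfTraj n).prodMk ((continuous_apply n).comp continuous_snd))
  have hV : mfValue G L N = fun f => ⨅ u : ℕ → U, mfCost hlim.1 hin L N f u :=
    funext (mfValue_eq hlim.1 hin N)
  constructor
  · rw [hV]
    have := isCompact_univ.continuous_sInf
      (f := fun (f : ProbabilityMeasure 𝒳) (u : ℕ → U) => mfCost hlim.1 hin L N f u) hcost
    simpa only [Set.image_univ, sSup_range, sInf_range] using this
  · intro ε hε
    have hunif := eventually_forall_abs_sub_lt (S := fun k => (Fin (φ k + 1) → 𝒳) × (ℕ → U))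
      (e := fun k s => (empirical s.1, s.2)) (h := fun k s => microCost hg ℓ N s.1 s.2) hcost
      (fun l p hl hp => ?_) (half_pos hε)
    · filter_upwards [hunif] with k hk X
      have hbdd : BddBelow (Set.range fun u : ℕ → U => mfCost hlim.1 hin L N (empirical X) u) :=
        ⟨0, by rintro _ ⟨u, rfl⟩; exact Finset.sum_nonneg fun _ _ => hL₀ _ _⟩
      have h1 : microValue hg ℓ N X - ε / 2 ≤ mfValue G L N (empirical X) := by
        rw [mfValue_eq hlim.1 hin]
        refine le_ciInf fun u => ?_
        have h2 := ciInf_le (hℓ.bddBelow_range_microCost (hg := hg) N X) u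
        have h3 := abs_lt.1 (hk (X, u))
        simp only [microValue] at *
        linarith
      have h4 : mfValue G L N (empirical X) - ε / 2 ≤ microValue hg ℓ N X := by
        refine le_ciInf fun u => ?_
        rw [mfValue_eq hlim.1 hin]
        have h2 := ciInf_le hbdd u
        have h3 := abs_lt.1 (hk (X, u))
        simp only at *
        linarith
      rw [abs_lt]
      constructor <;> linarith
    · have h1 := (continuous_fst.tendsto p).comp hp
      have h2 := (continuous_snd.tendsto p).comp hp
      refine tendsto_finsetSum _ fun n _ => ?_
      exact hL.tendsto hl (hlim.tendsto_microTraj hφ hl h1 h2 n) (tendsto_pi_nhds.1 h2 n)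

end

/-! ### Existence of mean-field limits and the performance bound -/

section

variable {𝒳 U : Set ℝ} {g : Interaction 𝒳} {hg : StaysIn U g} {ℓ : RunningCost 𝒳 U}
  {μM : Feedback 𝒳 U} {G : 𝒳 → ProbabilityMeasure 𝒳 → ℝ} {L : ProbabilityMeasure 𝒳 → U → ℝ}
  {μ : ProbabilityMeasure 𝒳 → U} {φ : ℕ → ℕ}

theorem IsModulus.exists_lt {ω : ℝ → ℝ} (hω : IsModulus ω) {ε : ℝ} (hε : 0 < ε) :
    ∃ δ > 0, ∀ t, 0 ≤ t → t < δ → ω t < ε := by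
  obtain ⟨δ, hδ, h⟩ := Metric.mem_nhdsWithin_iff.1 (hω.eventually (gt_mem_nhds hε))
  exact ⟨δ, hδ, fun t h0 h1 => h ⟨by
    rwa [Metric.mem_ball, Real.dist_0_eq_abs, abs_of_nonneg h0], h0⟩⟩

theorem separableSpace_probabilityMeasure [CompactSpace 𝒳] :
    TopologicalSpace.SeparableSpace (ProbabilityMeasure 𝒳) := by
  let := TopologicalSpace.metrizableSpaceMetric (ProbabilityMeasure 𝒳)
  infer_instance

theorem IsRegularInteraction.exists_isMeanFieldLimit [CompactSpace 𝒳] (hg : IsRegularInteraction g)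
    (hφ : StrictMono φ) : ∃ θ : ℕ → ℕ, StrictMono θ ∧ ∃ G : 𝒳 → ProbabilityMeasure 𝒳 → ℝ,
      IsMeanFieldLimitInteraction (φ ∘ θ) g G := by
  have := separableSpace_probabilityMeasure (𝒳 := 𝒳)
  -- the shift ensures that there are other agents
  have hne : ∀ k, NeZero (φ (k + 1)) := fun k => ⟨(hφ (Nat.succ_pos k)).ne_bot⟩
  have hshift : Tendsto (fun k => φ (k + 1)) atTop atTop :=
    hφ.tendsto_atTop.comp (tendsto_add_atTop_nat 1)
  obtain ⟨B, hB⟩ := hg.bounded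
  obtain ⟨ω, hω, hequi⟩ := hg.equicontinuous
  obtain ⟨θ, hθ, H, hHc, hH⟩ := exists_subseq_uniform_limit (P := 𝒳 × ProbabilityMeasure 𝒳)
    (d := fun p q => |(p.1 : ℝ) - q.1| + d₁ (p.2 : Measure 𝒳) (q.2 : Measure 𝒳))
    (Continuous.add (by fun_prop) (continuous_d₁.comp
      (by fun_prop : Continuous fun q : (𝒳 × ProbabilityMeasure 𝒳) × (𝒳 × ProbabilityMeasure 𝒳) =>
        (q.1.2, q.2.2)))) (by simp)
    (S := fun k => 𝒳 × (Fin (φ (k + 1)) → 𝒳)) (fun k s => (s.1, empirical s.2))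
    (fun k s => g _ s.1 s.2) (fun k s => hB _ _ _) (by
      intro ε hε
      obtain ⟨δ, hδ, hωδ⟩ := hω.exists_lt (half_pos hε)
      refine ⟨δ, hδ, fun k s t hst => (hequi _ _ _ _ _).trans_lt ?_⟩
      have h0 := d₁_nonneg (empiricalMeasure s.2) (empiricalMeasure t.2)
      have h1 : |(s.1 : ℝ) - t.1| + d₁ (empiricalMeasure s.2) (empiricalMeasure t.2) < δ := hst
      have h2 := abs_nonneg ((s.1 : ℝ) - t.1)
      linarith [hωδ _ h2 (by linarith), hωδ _ h0 (by linarith)]) (by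
      rintro ⟨x, f⟩
      obtain ⟨y, hy⟩ := exists_tendsto_empirical f
      exact ⟨fun k => (x, fun j => y j), tendsto_const_nhds.prodMk_nhds (hy _ hshift)⟩)
  refine ⟨fun k => θ k + 1, fun a b hab => Nat.add_lt_add_right (hθ hab) 1,
    fun x f => H (x, f), hHc, fun ε hε => ?_⟩
  filter_upwards [hH ε hε] with k hk _ x X
  exact hk (x, X)

theorem IsRegularCost.exists_isMeanFieldLimit [CompactSpace 𝒳] [CompactSpace U]
    (hℓ : IsRegularCost ℓ) (hφ : StrictMono φ) :
    ∃ θ : ℕ → ℕ, StrictMono θ ∧ ∃ L : ProbabilityMeasure 𝒳 → U → ℝ,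
      IsMeanFieldLimitCost (φ ∘ θ) ℓ L := by
  have := separableSpace_probabilityMeasure (𝒳 := 𝒳)
  have hshift : Tendsto (fun k => φ k + 1) atTop atTop :=
    (tendsto_add_atTop_nat 1).comp hφ.tendsto_atTop
  obtain ⟨B, hB⟩ := hℓ.bounded
  obtain ⟨ω, hω, hequi⟩ := hℓ.equicontinuous
  obtain ⟨θ, hθ, H, hHc, hH⟩ := exists_subseq_uniform_limit (P := ProbabilityMeasure 𝒳 × U)
    (d := fun p q => d₁ (p.1 : Measure 𝒳) (q.1 : Measure 𝒳) + |(p.2 : ℝ) - q.2|)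
    (Continuous.add (continuous_d₁.comp
      (by fun_prop : Continuous fun q : (ProbabilityMeasure 𝒳 × U) × (ProbabilityMeasure 𝒳 × U) =>
        (q.1.1, q.2.1))) (by fun_prop)) (by simp)
    (S := fun k => (Fin (φ k + 1) → 𝒳) × U) (fun k s => (empirical s.1, s.2))
    (fun k s => ℓ _ s.1 s.2) (fun k s => hB _ _ _) (by
      intro ε hε
      obtain ⟨δ, hδ, hωδ⟩ := hω.exists_lt (half_pos hε)
      refine ⟨δ, hδ, fun k s t hst => (hequi _ _ _ _ _).trans_lt ?_⟩
      have h0 := d₁_nonneg (empiricalMeasure s.1) (empiricalMeasure t.1)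
      have h1 : d₁ (empiricalMeasure s.1) (empiricalMeasure t.1) + |(s.2 : ℝ) - t.2| < δ := hst
      have h2 := abs_nonneg ((s.2 : ℝ) - t.2)
      linarith [hωδ _ h2 (by linarith), hωδ _ h0 (by linarith)]) (by
      rintro ⟨f, u⟩
      obtain ⟨y, hy⟩ := exists_tendsto_empirical f
      exact ⟨fun k => (fun j => y j, u), (hy _ hshift).prodMk_nhds tendsto_const_nhds⟩)
  refine ⟨θ, hθ, fun f u => H (f, u), hHc, fun ε hε => ?_⟩
  filter_upwards [hH ε hε] with k hk X u
  exact hk (X, u)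

theorem IsRegularFeedback.exists_isMeanFieldLimit [CompactSpace 𝒳] (hU : IsCompact U)
    (hμ : IsRegularFeedback μM) (hφ : StrictMono φ) :
    ∃ θ : ℕ → ℕ, StrictMono θ ∧ ∃ μ : ProbabilityMeasure 𝒳 → U,
      IsMeanFieldLimit (φ ∘ θ) (fun m X => (μM m X : ℝ)) (fun f => (μ f : ℝ)) := by
  have := separableSpace_probabilityMeasure (𝒳 := 𝒳)
  have hshift : Tendsto (fun k => φ k + 1) atTop atTop :=
    (tendsto_add_atTop_nat 1).comp hφ.tendsto_atTop
  obtain ⟨B, hB⟩ := hU.isBounded.exists_norm_le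
  obtain ⟨ω, hω, hequi⟩ := hμ.equicontinuous
  obtain ⟨θ, hθ, H, hHc, hH⟩ := exists_subseq_uniform_limit (P := ProbabilityMeasure 𝒳)
    (d := fun p q => d₁ (p : Measure 𝒳) (q : Measure 𝒳)) continuous_d₁ (by simp)
    (S := fun k => Fin (φ k + 1) → 𝒳) (fun k X => empirical X)
    (fun k X => (μM _ X : ℝ)) (fun k X => hB _ (μM _ X).2) (by
      intro ε hε
      obtain ⟨δ, hδ, hωδ⟩ := hω.exists_lt hε
      exact ⟨δ, hδ, fun k X Y hXY => (hequi _ _ _).trans_lt (hωδ _ (d₁_nonneg _ _) hXY)⟩) (by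
      intro f
      obtain ⟨y, hy⟩ := exists_tendsto_empirical f
      exact ⟨fun k j => y j, hy _ hshift⟩)
  have hlim : IsMeanFieldLimit (φ ∘ θ) (fun m X => (μM m X : ℝ)) H := ⟨hHc, hH⟩
  have hmem : ∀ f, H f ∈ U := by
    intro f
    obtain ⟨y, hy⟩ := exists_tendsto_empirical f
    exact hU.isClosed.mem_of_tendsto (hlim.tendsto tendsto_id
      ((hy _ hshift).comp hθ.tendsto_atTop)) (Eventually.of_forall fun k => (μM _ _).2)
  exact ⟨θ, hθ, fun f => ⟨H f, hmem f⟩, hlim⟩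

/-- Mean-field limits exist along a subsequence of any given sequence of numbers of agents. -/
theorem exists_areMeanFieldLimits [CompactSpace 𝒳] (hU : IsCompact U)
    (hg : IsRegularInteraction g) (hℓ : IsRegularCost ℓ) (hμ : IsRegularFeedback μM)
    (hφ : StrictMono φ) : ∃ θ : ℕ → ℕ, StrictMono θ ∧
      ∃ (G : 𝒳 → ProbabilityMeasure 𝒳 → ℝ) (L : ProbabilityMeasure 𝒳 → U → ℝ)
        (μ : ProbabilityMeasure 𝒳 → U), AreMeanFieldLimits (φ ∘ θ) g ℓ μM G L μ := by
  have := isCompact_iff_compactSpace.1 hU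
  obtain ⟨θ₁, hθ₁, G, hG⟩ := hg.exists_isMeanFieldLimit hφ
  obtain ⟨θ₂, hθ₂, L, hL⟩ := hℓ.exists_isMeanFieldLimit (hφ.comp hθ₁)
  obtain ⟨θ₃, hθ₃, μ, hμ⟩ := hμ.exists_isMeanFieldLimit hU ((hφ.comp hθ₁).comp hθ₂)
  exact ⟨θ₁ ∘ θ₂ ∘ θ₃, hθ₁.comp (hθ₂.comp hθ₃), G, L, μ,
    ⟨hG.1, fun ε hε => (hθ₂.comp hθ₃).tendsto_atTop.eventually (hG.2 ε hε)⟩,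
    ⟨hL.1, fun ε hε => hθ₃.tendsto_atTop.eventually (hL.2 ε hε)⟩, hμ⟩

theorem IsMeanFieldLimitCost.nonneg [CompactSpace 𝒳] (hL : IsMeanFieldLimitCost φ ℓ L)
    (hφ : StrictMono φ) (hℓ : IsRegularCost ℓ) (f : ProbabilityMeasure 𝒳) (u : U) : 0 ≤ L f u := by
  have hshift : Tendsto (fun k => φ k + 1) atTop atTop :=
    (tendsto_add_atTop_nat 1).comp hφ.tendsto_atTop
  obtain ⟨y, hy⟩ := exists_tendsto_empirical f
  exact ge_of_tendsto' (hL.tendsto tendsto_id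
    (hy _ hshift) tendsto_const_nhds)
    fun k => hℓ.nonneg _ _ _

/-- The relaxed dynamic programming inequality passes to the mean-field limit. -/
theorem mfValue_mfStep_add_le [CompactSpace 𝒳] {N : ℕ} {α : ℝ} (hφ : StrictMono φ)
    (hlim : AreMeanFieldLimits φ g ℓ μM G L μ) (hin : MFStaysIn U G)
    (hV : IsMeanFieldLimit φ (fun _ X => microValue hg ℓ N X) (mfValue G L N))
    (hdp : ∀ (m : ℕ) (X : Fin (m + 1) → 𝒳), microValue hg ℓ N (microStep hg X (μM m X))
      + α * ℓ m X (μM m X) ≤ microValue hg ℓ N X) (f : ProbabilityMeasure 𝒳) :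
    mfValue G L N (mfStep hlim.interaction.1 hin f (μ f)) + α * L f (μ f) ≤ mfValue G L N f := by
  have hshift : Tendsto (fun k => φ k + 1) atTop atTop :=
    (tendsto_add_atTop_nat 1).comp hφ.tendsto_atTop
  obtain ⟨y, hy⟩ := exists_tendsto_empirical f
  have hX := hy _ hshift
  have hu : Tendsto (fun k => μM (φ k) fun j => y j) atTop (𝓝 (μ f)) :=
    tendsto_subtype_rng.2 (hlim.feedback.tendsto tendsto_id hX)
  have hX1 := hlim.interaction.tendsto_microStep (hg := hg) (hG := hlim.interaction.1) (hin := hin)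
    hφ tendsto_id hX hu
  exact le_of_tendsto_of_tendsto' ((hV.tendsto tendsto_id hX1).add
    ((hlim.cost.tendsto tendsto_id hX hu).const_mul α)) (hV.tendsto tendsto_id hX)
    fun k => hdp _ _

/-- Telescoping the relaxed dynamic programming inequality along the closed loop. -/
theorem ofReal_mul_mfInfCost_le {α : ℝ} (hα : 0 ≤ α) {V : ProbabilityMeasure 𝒳 → ℝ}
    (hV₀ : ∀ f, 0 ≤ V f) (hL₀ : ∀ f u, 0 ≤ L f u) {F : ℕ → ProbabilityMeasure 𝒳}
    (hdp : ∀ n, V (F (n + 1)) + α * L (F n) (μ (F n)) ≤ V (F n)) :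
    ENNReal.ofReal α * mfInfCost L F (fun n => μ (F n)) ≤ ENNReal.ofReal (V (F 0)) := by
  rw [mfInfCost, ← ENNReal.tsum_mul_left]
  refine ENNReal.tsum_le_of_sum_range_le fun K => ?_
  have hsum : ∑ n ∈ Finset.range K, α * L (F n) (μ (F n)) + V (F K) ≤ V (F 0) := by
    induction K with
    | zero => simp
    | succ K ih => rw [Finset.sum_range_succ]; linarith [hdp K]
  simp only [← ENNReal.ofReal_mul hα]
  rw [← ENNReal.ofReal_sum_of_nonneg fun n _ => mul_nonneg hα (hL₀ _ _)]
  exact ENNReal.ofReal_le_ofReal (by linarith [hV₀ (F K)])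

end

end MeanFieldMPC

theorem lemma3 {𝒳 U : Set ℝ} (h𝒳 : IsCompact 𝒳) (hU : IsCompact U)
    (g : MeanFieldMPC.Interaction 𝒳) (hg : MeanFieldMPC.IsRegularInteraction g)
    (hinv : MeanFieldMPC.StaysIn U g)
    (ℓ : MeanFieldMPC.RunningCost 𝒳 U) (hℓ : MeanFieldMPC.IsRegularCost ℓ)
    (C σ α : ℝ) (hC : 1 ≤ C) (hσ₀ : 0 < σ) (hσ₁ : σ < 1) (hα₀ : 0 < α) (hα₁ : α ≤ 1)
    (N : ℕ) (hN : 2 ≤ N)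
    (hforce : ∀ (lam : ℕ → ℝ) (ν : ℝ), (∀ n < N, 0 < lam n) → 0 < ν →
      (∀ k : ℕ, k + 2 ≤ N →
        ∑ n ∈ Finset.Ico k N, lam n ≤ C * lam k * ((1 - σ ^ (N - k)) / (1 - σ))) →
      (∀ j : ℕ, j + 2 ≤ N →
        ν ≤ ∑ n ∈ Finset.range j, lam (n + 1)
          + C * lam (j + 1) * ((1 - σ ^ (N - j)) / (1 - σ))) →
      lam 0 * α ≤ ∑ n ∈ Finset.range N, lam n - ν) :
    -- the relaxed dynamic programming inequality, for every number `m + 1` of agents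
    (∀ (m : ℕ) (κ : (Fin (m + 1) → 𝒳) → U),
      MeanFieldMPC.ExpControllable hinv ℓ C σ m →
      MeanFieldMPC.IsMPCFeedback hinv ℓ N m κ →
      ∀ X : Fin (m + 1) → 𝒳,
        MeanFieldMPC.microValue hinv ℓ N (MeanFieldMPC.microStep hinv X (κ X))
          + α * ℓ m X (κ X) ≤ MeanFieldMPC.microValue hinv ℓ N X) ∧
    -- the mean-field performance bound
    (∀ μM : MeanFieldMPC.Feedback 𝒳 U,
      (∀ m : ℕ, MeanFieldMPC.ExpControllable hinv ℓ C σ m) →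
      (∀ m : ℕ, MeanFieldMPC.IsMPCFeedback hinv ℓ N m (μM m)) →
      MeanFieldMPC.IsRegularFeedback μM →
      -- mean-field limits exist along a further subsequence of any subsequence
      (∀ φ : ℕ → ℕ, StrictMono φ → ∃ θ : ℕ → ℕ, StrictMono θ ∧
        ∃ (G : 𝒳 → MeasureTheory.ProbabilityMeasure 𝒳 → ℝ)
          (L : MeasureTheory.ProbabilityMeasure 𝒳 → U → ℝ)
          (μ : MeasureTheory.ProbabilityMeasure 𝒳 → U),
          MeanFieldMPC.AreMeanFieldLimits (φ ∘ θ) g ℓ μM G L μ) ∧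
      -- and the bound holds for all of them
      ∀ (φ : ℕ → ℕ) (G : 𝒳 → MeasureTheory.ProbabilityMeasure 𝒳 → ℝ)
        (L : MeasureTheory.ProbabilityMeasure 𝒳 → U → ℝ)
        (μ : MeasureTheory.ProbabilityMeasure 𝒳 → U),
        StrictMono φ → MeanFieldMPC.AreMeanFieldLimits φ g ℓ μM G L μ →
        (∀ (f : MeasureTheory.ProbabilityMeasure 𝒳) (u : ℕ → U),
          ∃! F : ℕ → MeasureTheory.ProbabilityMeasure 𝒳,
            MeanFieldMPC.IsMeanFieldTraj G f u F) ∧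
        MeanFieldMPC.IsMeanFieldLimit φ
          (fun _ X => MeanFieldMPC.microValue hinv ℓ N X) (MeanFieldMPC.mfValue G L N) ∧
        ∀ f : MeasureTheory.ProbabilityMeasure 𝒳,
          (∃! F : ℕ → MeasureTheory.ProbabilityMeasure 𝒳,
            MeanFieldMPC.IsMeanFieldTraj G f (fun n => μ (F n)) F) ∧
          ∀ F : ℕ → MeasureTheory.ProbabilityMeasure 𝒳,
            MeanFieldMPC.IsMeanFieldTraj G f (fun n => μ (F n)) F →
            ENNReal.ofReal α * MeanFieldMPC.mfInfValue G L f ≤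
                ENNReal.ofReal α * MeanFieldMPC.mfInfCost L F (fun n => μ (F n)) ∧
              ENNReal.ofReal α * MeanFieldMPC.mfInfCost L F (fun n => μ (F n)) ≤
                ENNReal.ofReal (MeanFieldMPC.mfValue G L N f)) := by
  have := isCompact_iff_compactSpace.1 h𝒳
  have := isCompact_iff_compactSpace.1 hU
  have hdp : ∀ (m : ℕ) (κ : (Fin (m + 1) → 𝒳) → U), MeanFieldMPC.ExpControllable hinv ℓ C σ m →
      MeanFieldMPC.IsMPCFeedback hinv ℓ N m κ → ∀ X : Fin (m + 1) → 𝒳,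
        MeanFieldMPC.microValue hinv ℓ N (MeanFieldMPC.microStep hinv X (κ X))
          + α * ℓ m X (κ X) ≤ MeanFieldMPC.microValue hinv ℓ N X := fun m κ hctrl hκ X =>
    MeanFieldMPC.microValue_microStep_add_le hℓ hC hσ₀ hσ₁ hN hforce hctrl hκ X
  refine ⟨hdp, fun μM hctrl hmpc hμM => ⟨fun φ hφ =>
    MeanFieldMPC.exists_areMeanFieldLimits hU hg hℓ hμM hφ, fun φ G L μ hφ hlim => ?_⟩⟩
  have hG := hlim.interaction.1
  have hin := hlim.interaction.mfStaysIn hφ hinv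
  have hL₀ := hlim.cost.nonneg hφ hℓ
  have hV : MeanFieldMPC.IsMeanFieldLimit φ
      (fun _ X => MeanFieldMPC.microValue hinv ℓ N X) (MeanFieldMPC.mfValue G L N) := by
    rcases isEmpty_or_nonempty 𝒳 with hemp | ⟨⟨x⟩⟩
    · have : IsEmpty (ProbabilityMeasure 𝒳) := ⟨fun p => hemp.elim p.nonempty.some⟩
      exact ⟨continuous_of_discreteTopology,
        fun ε _ => Eventually.of_forall fun k X => hemp.elim (X 0)⟩
    · -- controllability provides control values
      obtain ⟨u, -⟩ := hctrl 0 fun _ => x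
      have : Nonempty U := ⟨u 0⟩
      exact MeanFieldMPC.isMeanFieldLimit_microValue hℓ hφ hlim.interaction hlim.cost hL₀ N
  have hV₀ : ∀ f, 0 ≤ MeanFieldMPC.mfValue G L N f := fun f => Real.sInf_nonneg (by
    rintro _ ⟨u, F, -, rfl⟩
    exact Finset.sum_nonneg fun _ _ => hL₀ _ _)
  refine ⟨fun f u => ?_, hV, fun f =>
    ⟨MeanFieldMPC.existsUnique_isMeanFieldTraj_feedback hG hin f μ, fun F hF => ⟨?_, ?_⟩⟩⟩
  · simp only [MeanFieldMPC.isMeanFieldTraj_iff_eq_mfTraj (hG := hG) (hin := hin), existsUnique_eq]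
  · gcongr
    exact sInf_le ⟨fun n => μ (F n), F, hF, rfl⟩
  · obtain ⟨hF0, hF⟩ := (MeanFieldMPC.isMeanFieldTraj_iff (hG := hG) (hin := hin)).1 hF
    have h := MeanFieldMPC.ofReal_mul_mfInfCost_le (μ := μ) (F := F) hα₀.le hV₀ hL₀ fun n => by
      rw [hF n]
      exact MeanFieldMPC.mfValue_mfStep_add_le hφ hlim hin hV
        (fun m X => hdp m (μM m) (hctrl m) (hmpc m) X) (F n)
    rwa [hF0] at h
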